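/- Let $f=\frac1n\sum_{i=1}^n f_i$ on $\mathbb{R}^d$, $n\ge 1$, where each $f_i$ is convex and $L$-smooth ($L>0$) and $f$ has a minimizer. Fix $\beta>1$, $\epsilon>0$, $x_0\in\mathbb{R}^d$. Algorithm R-Acc-SVRG-G (inputs $\epsilon$, $\delta_0=L$, $\beta$, $x_0$), IDC version. For $t=0,1,2,\dots$: let $f_i^{\delta_t}(x)=f_i(x)+\frac{\delta_t}{2}\|x-x_0\|^2$, $f^{\delta_t}=\frac1n\sum_i f_i^{\delta_t}$, $p=\frac1n$; let $\alpha$ be the unique positive root of $\bigl(1-\frac{p(\alpha+\delta_t)}{\alpha+L+\delta_t}\bigr)\bigl(1+\frac{\delta_t}{\alpha}\bigr)^2=1$, and let $\tau_x=\frac{\alpha+\delta_t}{\alpha+L+\delta_t}$, $\tau_z=\frac{\tau_x}{\delta_t}-\frac{\alpha(1-\tau_x)}{\delta_t L}$, $C=L^2+\frac{L\alpha^2p}{L+(1-p)(\alpha+\delta_t)}$. Put $z_0=\tilde x_0=x_0$. For $k=0,1,2,\dots$: set $y_k=\tau_xz_k+(1-\tau_x)\tilde x_k+\tau_z(\delta_t(\tilde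 x_k-z_k)-\nabla f^{\delta_t}(\tilde x_k))$; draw $i_k$ uniformly from $\{1,\dots,n\}$ and set $z_{k+1}=\arg\min_x\{\langle \mathcal G_k,x\rangle+\frac\alpha2\|x-z_k\|^2+\frac{\delta_t}{2}\|x-y_k\|^2\}$ with $\mathcal G_k=\nabla f_{i_k}^{\delta_t}(y_k)-\nabla f_{i_k}^{\delta_t}(\tilde x_k)+\nabla f^{\delta_t}(\tilde x_k)$; set $\tilde x_{k+1}=y_k$ with probability $p$ and $\tilde x_{k+1}=\tilde x_k$ otherwise; if $\|\nabla f(\tilde x_k)\|\le\epsilon$, output $\tilde x_k$ and terminate the algorithm; otherwise, if $(1+\frac{\delta_t}{\alpha})^k\ge\sqrt{C}/\delta_t$, break the inner loop and go to the next outer iteration with $\delta_{t+1}=\delta_t/\beta$. All random choices are independent. The oracle complexity is the number of evaluated component gradients $\nabla f_i$: $n$ for the full gradient at the start of each outer iteration, and in each inner iteration $2$, plus $n$ if $\tilde x_{k+1}=y_k$. Let $x^\star$ be a minimizer of $f$, let $\|x_0-x^\star\|\le R_0$ with $R_0>0$ (IDC), let $q\in(0,1)$, and let $\ell$ be the first $t$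 with $\delta_t\le\frac{\epsilon q}{2R_0}$. Neither $R_0$ nor $q$ is an input of the algorithm. Then: (i) If outer iteration $\ell$ is reached, the algorithm terminates in it with (conditional) probability at least $1-q$; consequently it has terminated by the end of outer iteration $\ell$ with probability at least $1-q$. (ii) The expected oracle complexity of the algorithm over the $\ell+1$ outer iterations $t=0,\dots,\ell$ is at most $$C_\beta\Bigl(n\,\Lambda+\sqrt{\tfrac{nLR_0}{\epsilon q}}\Bigr)\Lambda,\qquad \Lambda=\max\Bigl\{1,\log\tfrac{LR_0}{\epsilon q}\Bigr\},$$ where the constant $C_\beta$ depends only on $\beta$. In particular, it is $O\bigl(\bigl(n\log\frac{LR_0}{\epsilon q}+\sqrt{\frac{nLR_0}{\epsilon q}}\bigr)\log\frac{LR_0}{\epsilon q}\bigr)$ for $\frac{LR_0}{\epsilon q}\ge e$. -/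

import Mathlib

open MeasureTheory ProbabilityTheory
open scoped ENNReal

noncomputable section

namespace RAccSVRG

/-- The space `ℝ^d` with the Euclidean norm. -/
abbrev E (d : ℕ) := EuclideanSpace ℝ (Fin d)

/-- `g` is convex and `L`-smooth: differentiable, with `L`-Lipschitz gradient. -/
structure IsConvexSmooth {d : ℕ} (L : ℝ) (g : E d → ℝ) : Prop where
  convex : ConvexOn ℝ Set.univ g
  differentiable : Differentiable ℝ g
  lipschitz : ∀ x y, ‖gradient g x - gradient g y‖ ≤ L * ‖x - y‖

/-- The finite-sum objective `f = (1/n) ∑ i, f_i`. -/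
def avg {d n : ℕ} (f : Fin n → E d → ℝ) (x : E d) : ℝ := (1 / (n : ℝ)) * ∑ i, f i x

/-- The regularized function `g^δ(x) = g(x) + (δ/2) ‖x - x₀‖²`. -/
def reg {d : ℕ} (x₀ : E d) (δ : ℝ) (g : E d → ℝ) (x : E d) : ℝ := g x + δ / 2 * ‖x - x₀‖ ^ 2

/-- The full gradient of `f^δ = (1/n) ∑ i, f_i^δ`. -/
def fullGrad {d n : ℕ} (f : Fin n → E d → ℝ) (x₀ : E d) (δ : ℝ) (x : E d) : E d :=
  gradient (avg fun i => reg x₀ δ (f i)) x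

/-- The variance-reduced estimator
`G = ∇f_i^δ(y) - ∇f_i^δ(x̃) + ∇f^δ(x̃)`. -/
def estimator {d n : ℕ} (f : Fin n → E d → ℝ) (x₀ : E d) (δ : ℝ) (i : Fin n) (y xt : E d) : E d :=
  gradient (reg x₀ δ (f i)) y - gradient (reg x₀ δ (f i)) xt + fullGrad f x₀ δ xt

/-! ### Regularization parameters and step sizes -/

/-- `δ_0 = L`, `δ_{t+1} = δ_t / β`. -/
def delta (L β : ℝ) : ℕ → ℝ
  | 0 => L
  | t + 1 => delta L β t / β

/-- `a` is a positive root of `(1 - p (a + δ) / (a + L + δ)) (1 + δ / a)² = 1`, with `p = 1/n`. -/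
def IsAlpha (n : ℕ) (L δ a : ℝ) : Prop :=
  0 < a ∧ (1 - (1 / (n : ℝ)) * (a + δ) / (a + L + δ)) * (1 + δ / a) ^ 2 = 1

/-- The positive root; it exists and is unique by `existsUnique_alpha` below. -/
def alpha (n : ℕ) (L δ : ℝ) : ℝ := Classical.epsilon (IsAlpha n L δ)

theorem isAlpha_iff {n : ℕ} (hn : 0 < n) {L δ a : ℝ} (hL : 0 < L) (hδ : 0 < δ) (ha : 0 < a) :
    IsAlpha n L δ a ↔
      (a + δ) ^ 3 = n * δ * (a + δ + L) * (2 * (a + δ) - δ) := by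
  have hn' : (0 : ℝ) < n := by exact_mod_cast hn
  have h1 : a + L + δ ≠ 0 := by positivity
  unfold IsAlpha
  rw [show (1 - (1 / (n : ℝ)) * (a + δ) / (a + L + δ)) * (1 + δ / a) ^ 2
      = ((n * (a + L + δ) - (a + δ)) * (a + δ) ^ 2) / (n * (a + L + δ) * a ^ 2) by
    field_simp, div_eq_one_iff_eq (by positivity)]
  constructor
  · rintro ⟨-, h⟩
    linarith
  · intro h
    exact ⟨ha, by linarith⟩

theorem existsUnique_alpha {n : ℕ} (hn : 0 < n) {L δ : ℝ} (hL : 0 < L) (hδ : 0 < δ) :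
    ∃! a, IsAlpha n L δ a := by
  have hn1 : (1 : ℝ) ≤ n := by exact_mod_cast hn
  have hex : ∃ a, 0 < a ∧
      (a + δ) ^ 3 = n * δ * (a + δ + L) * (2 * (a + δ) - δ) := by
    let g : ℝ → ℝ := fun a => (a + δ) ^ 3 - n * δ * (a + δ + L) * (2 * (a + δ) - δ)
    have hg : Continuous g := by fun_prop
    have hnδ : 0 < n * δ := by positivity
    have h0 : g 0 < 0 := by
      have e : g 0 = - (δ ^ 3 * (n - 1) + n * δ * δ * L) := by simp only [g]; ring
      have : 0 ≤ δ ^ 3 * (n - 1 : ℝ) := mul_nonneg (by positivity) (by linarith)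
      have : 0 < n * δ * δ * L := by positivity
      linarith
    have h1 : 0 < g (2 * (n * δ) + L) := by
      have e : g (2 * (n * δ) + L)
          = (2 * (n * δ) + L + δ) * ((2 * (n * δ) + L + δ) * (L + δ) - 2 * (n * δ) * L)
            + n * δ * δ * (2 * (n * δ) + L + δ + L) := by
        simp only [g]; ring
      have e2 : (2 * (n * δ) + L + δ) * (L + δ) - 2 * (n * δ) * L
          = 2 * (n * δ) * δ + (L + δ) ^ 2 := by ring
      rw [e, e2]
      positivity
    have hle : (0 : ℝ) ≤ 2 * (n * δ) + L := by positivity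
    obtain ⟨a, ha, hga⟩ := intermediate_value_Icc hle hg.continuousOn ⟨h0.le, h1.le⟩
    refine ⟨a, lt_of_le_of_ne ha.1 ?_, by simp only [g] at hga; linarith⟩
    rintro rfl
    exact h0.ne hga
  obtain ⟨a, ha, hroot⟩ := hex
  have key : ∀ u v : ℝ, δ < u → u < v →
      u ^ 3 = n * δ * (u + L) * (2 * u - δ) → v ^ 3 = n * δ * (v + L) * (2 * v - δ) → False := by
    intro u v hu huv h1 h2
    have hu0 : 0 < u := hδ.trans hu
    have hv0 : 0 < v := hu0.trans huv
    have hA : (v + L) * u < (u + L) * v := by nlinarith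
    have hB : (2 * v - δ) * u ^ 2 ≤ (2 * u - δ) * v ^ 2 := by
      have : 0 ≤ (v - u) * (u * (v - δ) + v * (u - δ)) :=
        mul_nonneg (by linarith) (add_nonneg (mul_nonneg hu0.le (by linarith))
          (mul_nonneg hv0.le (by linarith)))
      nlinarith
    have hC : ((v + L) * u) * ((2 * v - δ) * u ^ 2) < ((u + L) * v) * ((2 * u - δ) * v ^ 2) := by
      have hpos : 0 < (2 * v - δ) * u ^ 2 := mul_pos (by linarith) (by positivity)
      calc _ < ((u + L) * v) * ((2 * v - δ) * u ^ 2) := mul_lt_mul_of_pos_right hA hpos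
        _ ≤ _ := mul_le_mul_of_nonneg_left hB (by positivity)
    have hD : (n * δ) * (((v + L) * u) * ((2 * v - δ) * u ^ 2))
        = (n * δ) * (((u + L) * v) * ((2 * u - δ) * v ^ 2)) := by
      calc _ = (n * δ * (v + L) * (2 * v - δ)) * u ^ 3 := by ring
        _ = (n * δ * (u + L) * (2 * u - δ)) * v ^ 3 := by rw [← h1, ← h2]; ring
        _ = _ := by ring
    have hnδ : 0 < n * δ := by positivity
    exact hC.ne (mul_left_cancel₀ hnδ.ne' hD)
  refine ⟨a, (isAlpha_iff hn hL hδ ha).2 hroot, ?_⟩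
  intro b hb
  have hb' := (isAlpha_iff hn hL hδ hb.1).1 hb
  rcases lt_trichotomy b a with h | h | h
  · exact (key (b + δ) (a + δ) (by linarith [hb.1]) (by linarith) hb' hroot).elim
  · exact h
  · exact (key (a + δ) (b + δ) (by linarith) (by linarith) hroot hb').elim

theorem alpha_spec {n : ℕ} (hn : 0 < n) {L δ : ℝ} (hL : 0 < L) (hδ : 0 < δ) :
    IsAlpha n L δ (alpha n L δ) :=
  Classical.epsilon_spec (existsUnique_alpha hn hL hδ).exists

/-- `τ_x = (α + δ) / (α + L + δ)`. -/
def tauX (n : ℕ) (L δ : ℝ) : ℝ := (alpha n L δ + δ) / (alpha n L δ + L + δ)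

/-- `τ_z = τ_x / δ - α (1 - τ_x) / (δ L)`. -/
def tauZ (n : ℕ) (L δ : ℝ) : ℝ :=
  tauX n L δ / δ - alpha n L δ * (1 - tauX n L δ) / (δ * L)

/-- `C_IDC = L² + L α² p / (L + (1 - p) (α + δ))`, with `p = 1/n`. -/
def CIDC (n : ℕ) (L δ : ℝ) : ℝ :=
  L ^ 2 + L * alpha n L δ ^ 2 * (1 / (n : ℝ)) /
    (L + (1 - 1 / (n : ℝ)) * (alpha n L δ + δ))

/-! ### The inner loop -/

/-- `argmin_x { ⟨G, x⟩ + (α/2) ‖x - z‖² + (δ/2) ‖x - y‖² }` in closed form;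
see `proxStep_isMin` and `proxStep_unique`. -/
def proxStep {d : ℕ} (α δ : ℝ) (G z y : E d) : E d := (α + δ)⁻¹ • (α • z + δ • y - G)

/-- The function minimized by `proxStep`. -/
def proxObj {d : ℕ} (α δ : ℝ) (G z y x : E d) : ℝ :=
  inner ℝ G x + α / 2 * ‖x - z‖ ^ 2 + δ / 2 * ‖x - y‖ ^ 2

theorem proxObj_eq {d : ℕ} {α δ : ℝ} (h : 0 < α + δ) (G z y x : E d) :
    proxObj α δ G z y x = proxObj α δ G z y (proxStep α δ G z y)
      + (α + δ) / 2 * ‖x - proxStep α δ G z y‖ ^ 2 := by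
  set w := proxStep α δ G z y with hw
  have hG : G = α • z + δ • y - (α + δ) • w := by
    rw [hw, proxStep, smul_smul, mul_inv_cancel₀ h.ne', one_smul]; abel
  unfold proxObj
  rw [hG]
  simp only [← real_inner_self_eq_norm_sq, inner_sub_left, inner_sub_right, inner_add_left,
    inner_smul_left, RCLike.conj_to_real, real_inner_comm w x,
    real_inner_comm z x, real_inner_comm y x, real_inner_comm z w, real_inner_comm y w]
  ring

theorem proxStep_isMin {d : ℕ} {α δ : ℝ} (h : 0 < α + δ) (G z y : E d) :
    IsMinOn (proxObj α δ G z y) Set.univ (proxStep α δ G z y) := by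
  intro x _
  change proxObj α δ G z y (proxStep α δ G z y) ≤ proxObj α δ G z y x
  rw [proxObj_eq h G z y x]
  exact le_add_of_nonneg_right (by positivity)

theorem proxStep_unique {d : ℕ} {α δ : ℝ} (h : 0 < α + δ) (G z y w : E d)
    (hw : IsMinOn (proxObj α δ G z y) Set.univ w) : w = proxStep α δ G z y := by
  have h1 : proxObj α δ G z y w ≤ proxObj α δ G z y (proxStep α δ G z y) := hw (Set.mem_univ _)
  rw [proxObj_eq h G z y w] at h1
  have h2 : ‖w - proxStep α δ G z y‖ ^ 2 ≤ 0 := by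
    by_contra hc
    have : 0 < (α + δ) / 2 * ‖w - proxStep α δ G z y‖ ^ 2 :=
      mul_pos (by linarith) (not_le.1 hc)
    linarith
  have h3 : ‖w - proxStep α δ G z y‖ = 0 := by
    have := sq_nonneg ‖w - proxStep α δ G z y‖
    exact pow_eq_zero_iff (two_ne_zero) |>.1 (le_antisymm h2 this)
  exact sub_eq_zero.1 (norm_eq_zero.1 h3)

/-- `y_k = τ_x z_k + (1 - τ_x) x̃_k + τ_z (δ (x̃_k - z_k) - ∇f^δ(x̃_k))`. -/
def yStep {d n : ℕ} (f : Fin n → E d → ℝ) (L : ℝ) (x₀ : E d) (δ : ℝ) (z xt : E d) : E d :=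
  tauX n L δ • z + (1 - tauX n L δ) • xt
    + tauZ n L δ • (δ • (xt - z) - fullGrad f x₀ δ xt)

/-- The pair `(z_k, x̃_k)` of the inner loop with regularization parameter `δ`, driven by the
sampled indices `i_k` and the coins `b_k` (`true` means that `x̃_{k+1} = y_k`). -/
def innerState {d n : ℕ} (f : Fin n → E d → ℝ) (L : ℝ) (x₀ : E d) (δ : ℝ)
    (i : ℕ → Fin n) (b : ℕ → Bool) : ℕ → E d × E d
  | 0 => (x₀, x₀)
  | k + 1 =>
    let z := (innerState f L x₀ δ i b k).1
    let xt := (innerState f L x₀ δ i b k).2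
    let y := yStep f L x₀ δ z xt
    (proxStep (alpha n L δ) δ (estimator f x₀ δ (i k) y xt) z y, if b k then y else xt)

/-- The test `‖∇f(x̃_k)‖ ≤ ε`, upon which the whole algorithm outputs `x̃_k` and terminates. -/
def StopTest {d n : ℕ} (f : Fin n → E d → ℝ) (L ε : ℝ) (x₀ : E d) (δ : ℝ)
    (i : ℕ → Fin n) (b : ℕ → Bool) (k : ℕ) : Prop :=
  ‖gradient (avg f) (innerState f L x₀ δ i b k).2‖ ≤ ε

/-- The test `(1 + δ/α)^k ≥ √C_IDC / δ`, upon which the inner loop is broken. -/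
def BreakTest (n : ℕ) (L δ : ℝ) (k : ℕ) : Prop :=
  Real.sqrt (CIDC n L δ) / δ ≤ (1 + δ / alpha n L δ) ^ k

/-- Inner iteration `k` is executed, once the inner loop has been started. -/
def InnerReached {d n : ℕ} (f : Fin n → E d → ℝ) (L ε : ℝ) (x₀ : E d) (δ : ℝ)
    (i : ℕ → Fin n) (b : ℕ → Bool) (k : ℕ) : Prop :=
  ∀ j < k, ¬ StopTest f L ε x₀ δ i b j ∧ ¬ BreakTest n L δ j

/-- The inner loop ends because the whole algorithm terminates. -/
def LoopTerminates {d n : ℕ} (f : Fin n → E d → ℝ) (L ε : ℝ) (x₀ : E d) (δ : ℝ)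
    (i : ℕ → Fin n) (b : ℕ → Bool) : Prop :=
  ∃ k, InnerReached f L ε x₀ δ i b k ∧ StopTest f L ε x₀ δ i b k

/-- The inner loop is broken without termination of the algorithm (at each inner iteration the
termination test comes before the break test). -/
def LoopBreaks {d n : ℕ} (f : Fin n → E d → ℝ) (L ε : ℝ) (x₀ : E d) (δ : ℝ)
    (i : ℕ → Fin n) (b : ℕ → Bool) : Prop :=
  ∃ k, InnerReached f L ε x₀ δ i b k ∧ ¬ StopTest f L ε x₀ δ i b k ∧ BreakTest n L δ k

/-- Number of component gradients evaluated by a run of the inner loop: `n` for the full gradient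
at the starting point and, in every executed inner iteration, `2` for the estimator (one at `y_k`
and one at `x̃_k`) plus `n` for the new full gradient if `x̃_{k+1} = y_k`. -/
def loopCost {d n : ℕ} (f : Fin n → E d → ℝ) (L ε : ℝ) (x₀ : E d) (δ : ℝ)
    (i : ℕ → Fin n) (b : ℕ → Bool) : ℝ≥0∞ :=
  n + ∑' k, Set.indicator {k | InnerReached f L ε x₀ δ i b k}
    (fun k => if b k then (2 + n : ℝ≥0∞) else 2) k

/-! ### The outer loop

The inputs are `f`, `L`, `ε`, `β`, `x₀`, together with the random choices: `i t k` and `b t k` are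
the index and the coin of inner iteration `k` of outer iteration `t`. -/

/-- Outer iteration `t` is executed: all earlier inner loops were broken. -/
def OuterReached {d n : ℕ} (f : Fin n → E d → ℝ) (L ε β : ℝ) (x₀ : E d)
    (i : ℕ → ℕ → Fin n) (b : ℕ → ℕ → Bool) (t : ℕ) : Prop :=
  ∀ s < t, LoopBreaks f L ε x₀ (delta L β s) (i s) (b s)

/-- The algorithm terminates at outer iteration `t`. -/
def TerminatesAt {d n : ℕ} (f : Fin n → E d → ℝ) (L ε β : ℝ) (x₀ : E d)
    (i : ℕ → ℕ → Fin n) (b : ℕ → ℕ → Bool) (t : ℕ) : Prop :=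
  OuterReached f L ε β x₀ i b t ∧ LoopTerminates f L ε x₀ (delta L β t) (i t) (b t)

/-- Number of component gradients evaluated by the algorithm in outer iterations `0, …, l`. -/
def totalCost {d n : ℕ} (f : Fin n → E d → ℝ) (L ε β : ℝ) (x₀ : E d)
    (i : ℕ → ℕ → Fin n) (b : ℕ → ℕ → Bool) (l : ℕ) : ℝ≥0∞ :=
  ∑ t ∈ Finset.range (l + 1), Set.indicator {t | OuterReached f L ε β x₀ i b t}
    (fun t => loopCost f L ε x₀ (delta L β t) (i t) (b t)) t

/-- The random choices: indices uniform on `{1, …, n}`, coins `true` with probability `p = 1/n`,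
all of them independent. -/
structure IsSampling {Ω : Type*} [MeasurableSpace Ω] (μ : Measure Ω) {n : ℕ}
    (i : ℕ → ℕ → Ω → Fin n) (b : ℕ → ℕ → Ω → Bool) : Prop where
  measurable_index : ∀ t k, Measurable (i t k)
  measurable_coin : ∀ t k, Measurable (b t k)
  uniform : ∀ t k j, μ.real {ω | i t k ω = j} = 1 / (n : ℝ)
  coin : ∀ t k, μ.real {ω | b t k ω = true} = 1 / (n : ℝ)
  indep_index_coin : ∀ t k, IndepFun (i t k) (b t k) μ
  indep : iIndepFun (fun (s : ℕ × ℕ) ω => (i s.1 s.2 ω, b s.1 s.2 ω)) μ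

end RAccSVRG

end

noncomputable section

namespace RAccSVRG

/-! Fix one outer iteration, with parameter `δ`, and let `c` minimize `f^δ`. Then `∇f(c) = -δ(c -
x₀)`, and comparison with `x⋆` gives `‖x₀ - c‖ ≤ R₀`, so `‖∇f(c)‖ ≤ δR₀`. Written relative to `c`,
the updates of `y` and `z` contain only gradient differences of the unregularized functions
(`yStep_eq`, `proxStep_estimator_eq`). Expanding `‖z_{k+1} - c‖²`, with the variance absorbed by
cocoercivity, shows that `potential` shrinks in mean by the factor `(α/(α+δ))²` per step
(`mean_potential_innerStep_le`); the equation defining `α` is what gives both of its terms this same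
factor.

The break test involves no randomness, so the inner loop has a deterministic last index `K =
breakIndex`, and it holds exactly when the accumulated contraction brings the constant `C` below
`δ²`. Hence `E‖∇f(x̃_K) - ∇f(c)‖² ≤ (δR₀)²` and `E‖∇f(x̃_K)‖ ≤ 2δR₀`, which is at most `εq` at outer
iteration `ℓ`. Markov's inequality bounds the failure probability of that loop by `q`. Different
outer iterations use disjoint independent samples, so reaching iteration `ℓ` does not affect this
bound.

For the cost, early stopping is ignored: each of the at most `K + 1` inner iterations costs `2 + n ·
(1/n) = 3` in mean. The cubic for `α` gives `K ≤ (2n + √(2nL/δ)) log(2L/δ) + 1`. Over `t ≤ ℓ` the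
square roots form a geometric series governed by its last term, while the number of outer iterations
and each logarithm are `O(Λ)`. -/

/-! ### Inequalities for smooth convex functions -/

theorem hasDerivAt_along_line {d : ℕ} {g : E d → ℝ} (hg : Differentiable ℝ g) (x v : E d) (t : ℝ) :
    HasDerivAt (fun s : ℝ => g (x + s • v)) (inner ℝ (gradient g (x + t • v)) v) t := by
  have h1 : HasDerivAt (fun s : ℝ => x + s • v) v t := by
    simpa using ((hasDerivAt_id t).smul_const v).const_add x
  have h2 := ((hg (x + t • v)).hasFDerivAt).comp_hasDerivAt t h1
  rwa [← inner_gradient_left] at h2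

namespace IsConvexSmooth

variable {d : ℕ} {L : ℝ} {g : E d → ℝ}

theorem gradient_inequality (hg : IsConvexSmooth L g) (x y : E d) :
    g x + inner ℝ (gradient g x) (y - x) ≤ g y := by
  have hconv : ConvexOn ℝ Set.univ (fun s : ℝ => g (x + s • (y - x))) := by
    have := hg.convex.comp_affineMap (AffineMap.lineMap x y : ℝ →ᵃ[ℝ] E d)
    rw [Set.preimage_univ] at this
    refine this.congr fun s _ => ?_
    simp [AffineMap.lineMap_apply, add_comm]
  have h := hconv.le_slope_of_hasDerivAt (Set.mem_univ 0) (Set.mem_univ 1) one_pos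
    (hasDerivAt_along_line hg.differentiable x (y - x) 0)
  simp only [slope_def_field, zero_smul, one_smul, add_zero, add_sub_cancel, sub_zero,
    div_one] at h
  linarith

/-- Along the segment, `g` minus its quadratic model has nonpositive derivative by the Lipschitz
bound and Cauchy–Schwarz. -/
theorem descent (hg : IsConvexSmooth L g) (x y : E d) :
    g y ≤ g x + inner ℝ (gradient g x) (y - x) + L / 2 * ‖y - x‖ ^ 2 := by
  set v := y - x with hv
  let ψ : ℝ → ℝ := fun s => g (x + s • v) - s * inner ℝ (gradient g x) v - L / 2 * ‖v‖ ^ 2 * s ^ 2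
  have hψ : ∀ s, HasDerivAt ψ (inner ℝ (gradient g (x + s • v)) v - inner ℝ (gradient g x) v
      - L * ‖v‖ ^ 2 * s) s := by
    intro s
    have h1 := hasDerivAt_along_line hg.differentiable x v s
    have h2 := (hasDerivAt_id s).mul_const (inner ℝ (gradient g x) v)
    have h3 := (hasDerivAt_pow 2 s).const_mul (L / 2 * ‖v‖ ^ 2)
    refine ((h1.sub h2).sub h3).congr_deriv ?_
    simp
    ring
  have hanti : AntitoneOn ψ (Set.Icc 0 1) := by
    refine antitoneOn_of_deriv_nonpos (convex_Icc 0 1)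
      (fun s _ => (hψ s).continuousAt.continuousWithinAt)
      (fun s _ => (hψ s).differentiableAt.differentiableWithinAt) fun s hs => ?_
    rw [interior_Icc] at hs
    rw [(hψ s).deriv, ← inner_sub_left]
    have h1 := real_inner_le_norm (gradient g (x + s • v) - gradient g x) v
    have h2 := hg.lipschitz (x + s • v) x
    rw [add_sub_cancel_left, norm_smul, Real.norm_of_nonneg hs.1.le] at h2
    nlinarith [mul_le_mul_of_nonneg_right h2 (norm_nonneg v)]
  have h := hanti (Set.left_mem_Icc.2 zero_le_one) (Set.right_mem_Icc.2 zero_le_one) zero_le_one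
  simp only [ψ, zero_smul, one_smul, add_zero] at h
  rw [hv, add_sub_cancel, ← hv] at h
  linarith

/-- The gradient step `y - D/L`, with `D` the gradient difference, is bounded above by descent from
`y` and below by the tangent plane at `x`. -/
theorem cocoercive (hL : 0 < L) (hg : IsConvexSmooth L g) (x y : E d) :
    ‖gradient g y - gradient g x‖ ^ 2 ≤
      2 * L * (g y - g x - inner ℝ (gradient g x) (y - x)) := by
  set D := gradient g y - gradient g x with hD
  have h1 := hg.descent y (y - L⁻¹ • D)
  have h2 := hg.gradient_inequality x (y - L⁻¹ • D)
  have e1 : y - L⁻¹ • D - y = -(L⁻¹ • D) := by abel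
  have e2 : y - L⁻¹ • D - x = (y - x) - L⁻¹ • D := by abel
  rw [e1, norm_neg, norm_smul, inner_neg_right, inner_smul_right,
    Real.norm_of_nonneg (inv_nonneg.2 hL.le)] at h1
  rw [e2, inner_sub_right, inner_smul_right] at h2
  have h3 : inner ℝ (gradient g y) D = inner ℝ (gradient g x) D + ‖D‖ ^ 2 := by
    rw [← real_inner_self_eq_norm_sq, ← inner_add_left, hD]
    simp
  rw [h3] at h1
  have h4 : L / 2 * (L⁻¹ * ‖D‖) ^ 2 = L⁻¹ / 2 * ‖D‖ ^ 2 := by field_simp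
  have h5 : L⁻¹ / 2 * ‖D‖ ^ 2 ≤ g y - g x - inner ℝ (gradient g x) (y - x) := by
    linarith
  calc ‖D‖ ^ 2 = 2 * L * (L⁻¹ / 2 * ‖D‖ ^ 2) := by field_simp
    _ ≤ _ := mul_le_mul_of_nonneg_left h5 (by positivity)

end IsConvexSmooth

/-! ### Regularized functions, averages and the regularized minimizer -/

theorem hasGradientAt_reg {d : ℕ} {g : E d → ℝ} {x : E d} (hg : DifferentiableAt ℝ g x)
    (x₀ : E d) (δ : ℝ) : HasGradientAt (reg x₀ δ g) (gradient g x + δ • (x - x₀)) x := by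
  rw [hasGradientAt_iff_hasFDerivAt]
  have h1 := hg.hasFDerivAt
  have h2 := (((hasFDerivAt_id x).sub_const x₀).norm_sq).const_mul (δ / 2)
  refine (h1.add h2).congr_fderiv ?_
  ext w
  simp
  ring

theorem hasGradientAt_avg {d n : ℕ} {f : Fin n → E d → ℝ} {x : E d} {g : Fin n → E d}
    (hf : ∀ j, HasGradientAt (f j) (g j) x) :
    HasGradientAt (avg f) ((1 / (n : ℝ)) • ∑ j, g j) x := by
  rw [hasGradientAt_iff_hasFDerivAt]
  have h := (HasFDerivAt.fun_sum fun j (_ : j ∈ Finset.univ) =>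
    (hasGradientAt_iff_hasFDerivAt.1 (hf j))).const_mul (1 / (n : ℝ))
  refine h.congr_fderiv ?_
  ext w
  simp

section FiniteSum

variable {d n : ℕ} {L : ℝ} {f : Fin n → E d → ℝ}

theorem gradient_avg (hf : ∀ j, Differentiable ℝ (f j)) (x : E d) :
    gradient (avg f) x = (1 / (n : ℝ)) • ∑ j, gradient (f j) x :=
  (hasGradientAt_avg fun j => (hf j x).hasGradientAt).gradient

theorem gradient_reg {g : E d → ℝ} (hg : Differentiable ℝ g) (x₀ : E d) (δ : ℝ) (x : E d) :
    gradient (reg x₀ δ g) x = gradient g x + δ • (x - x₀) :=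
  (hasGradientAt_reg (hg x) x₀ δ).gradient

theorem fullGrad_eq (hn : 0 < n) (hf : ∀ j, Differentiable ℝ (f j)) (x₀ : E d) (δ : ℝ) (x : E d) :
    fullGrad f x₀ δ x = gradient (avg f) x + δ • (x - x₀) := by
  have hn' : (n : ℝ) ≠ 0 := by exact_mod_cast hn.ne'
  rw [fullGrad, (hasGradientAt_avg fun j => hasGradientAt_reg (hf j x) x₀ δ).gradient,
    gradient_avg hf, Finset.sum_add_distrib, smul_add, Finset.sum_const, Finset.card_univ,
    Fintype.card_fin, ← Nat.cast_smul_eq_nsmul ℝ, smul_smul, one_div, inv_mul_cancel₀ hn', one_smul]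

theorem isConvexSmooth_avg (hn : 0 < n) (hf : ∀ j, IsConvexSmooth L (f j)) :
    IsConvexSmooth L (avg f) := by
  have hn' : (0 : ℝ) < n := by exact_mod_cast hn
  refine ⟨?_, ?_, ?_⟩
  · have h : ConvexOn ℝ Set.univ (fun x => ∑ j, f j x) := by
      refine ⟨convex_univ, fun x _ y _ a b ha hb hab => ?_⟩
      rw [Finset.smul_sum, Finset.smul_sum, ← Finset.sum_add_distrib]
      exact Finset.sum_le_sum fun j _ =>
        (hf j).convex.2 (Set.mem_univ x) (Set.mem_univ y) ha hb hab
    exact h.smul (by positivity : (0 : ℝ) ≤ 1 / n)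
  · exact fun x => (hasGradientAt_avg fun j =>
      ((hf j).differentiable x).hasGradientAt).differentiableAt
  · intro x y
    rw [gradient_avg fun j => (hf j).differentiable, gradient_avg fun j => (hf j).differentiable,
      ← smul_sub, ← Finset.sum_sub_distrib, norm_smul, Real.norm_of_nonneg (by positivity)]
    calc 1 / (n : ℝ) * ‖∑ j, (gradient (f j) x - gradient (f j) y)‖
        ≤ 1 / (n : ℝ) * ∑ _j : Fin n, L * ‖x - y‖ := by
          gcongr
          exact norm_sum_le_of_le _ fun j _ => (hf j).lipschitz x y
      _ = L * ‖x - y‖ := by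
          rw [Finset.sum_const, Finset.card_univ, Fintype.card_fin, nsmul_eq_mul]
          field_simp

/-- The minimizer of the regularized objective is no farther from `x₀` than a minimizer of the
objective. -/
theorem exists_regularized_minimizer (hF : IsConvexSmooth L (avg f)) {x₀ xs : E d} {δ : ℝ}
    (hδ : 0 < δ) (hxs : IsMinOn (avg f) Set.univ xs) :
    ∃ c : E d, gradient (avg f) c + δ • (c - x₀) = 0 ∧ ‖x₀ - c‖ ≤ ‖x₀ - xs‖ := by
  have hmin : ∀ x, avg f xs ≤ avg f x := fun x => hxs (Set.mem_univ x)
  have hcont : Continuous (reg x₀ δ (avg f)) := by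
    have := hF.differentiable.continuous
    unfold reg
    fun_prop
  have hlim : Filter.Tendsto (reg x₀ δ (avg f)) (Filter.cocompact (E d)) Filter.atTop := by
    have h1 : Filter.Tendsto (fun x : E d => ‖x - x₀‖) (Filter.cocompact (E d)) Filter.atTop :=
      tendsto_norm_cocompact_atTop.comp
        (Homeomorph.subRight x₀).isClosedEmbedding.tendsto_cocompact
    have h2 := Filter.tendsto_atTop_add_const_left _ (avg f xs)
      (((Filter.tendsto_pow_atTop two_ne_zero).comp h1).const_mul_atTop (half_pos hδ))
    refine Filter.tendsto_atTop_mono (fun x => ?_) h2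
    simp only [reg, Function.comp]
    linarith [hmin x]
  obtain ⟨c, hc⟩ := hcont.exists_forall_le hlim
  refine ⟨c, ?_, ?_⟩
  · rw [← gradient_reg hF.differentiable]
    have h1 : fderiv ℝ (reg x₀ δ (avg f)) c = 0 :=
      IsLocalMin.fderiv_eq_zero (Filter.Eventually.of_forall hc)
    rw [gradient, h1, map_zero]
  -- The objective is no smaller at `c` than at `xs`, so the penalty at `c` must be no larger.
  · have h1 := hc xs
    simp only [reg] at h1
    have h2 : δ / 2 * ‖c - x₀‖ ^ 2 ≤ δ / 2 * ‖xs - x₀‖ ^ 2 := by linarith [hmin c]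
    have h3 := le_of_mul_le_mul_left h2 (half_pos hδ)
    rw [norm_sub_rev x₀ c, norm_sub_rev x₀ xs]
    exact le_of_sq_le_sq h3 (norm_nonneg _)

end FiniteSum

/-- The Bregman divergence of `g` at the base point `c`. -/
def bregman {d : ℕ} (g : E d → ℝ) (c x : E d) : ℝ := g x - g c - inner ℝ (gradient g c) (x - c)

namespace IsConvexSmooth

variable {d : ℕ} {L : ℝ} {g : E d → ℝ}

theorem bregman_le (hg : IsConvexSmooth L g) (c x : E d) :
    bregman g c x ≤ L / 2 * ‖x - c‖ ^ 2 := by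
  have := hg.descent c x
  unfold bregman
  linarith

theorem norm_gradient_sub_sq_le (hL : 0 < L) (hg : IsConvexSmooth L g) (c x : E d) :
    ‖gradient g x - gradient g c‖ ^ 2 ≤ 2 * L * bregman g c x :=
  hg.cocoercive hL c x

theorem bregman_le_inner (hg : IsConvexSmooth L g) (c x : E d) :
    bregman g c x ≤ inner ℝ (gradient g x - gradient g c) (x - c) := by
  have := hg.gradient_inequality x c
  rw [← neg_sub x c, inner_neg_right] at this
  unfold bregman
  rw [inner_sub_left]
  linarith

end IsConvexSmooth

/-! ### Identities for the step sizes -/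

section Parameters

variable {n : ℕ} {L δ : ℝ}

theorem alpha_pos (hn : 0 < n) (hL : 0 < L) (hδ : 0 < δ) : 0 < alpha n L δ :=
  (alpha_spec hn hL hδ).1

/-- The contraction factor of the inner loop. -/
theorem contraction_eq (hn : 0 < n) (hL : 0 < L) (hδ : 0 < δ) :
    (alpha n L δ / (alpha n L δ + δ)) ^ 2
      = 1 - 1 / (n : ℝ) * (alpha n L δ + δ) / (alpha n L δ + L + δ) := by
  have hα := alpha_pos hn hL hδ
  have h := (alpha_spec hn hL hδ).2
  have h1 : (1 + δ / alpha n L δ) * (alpha n L δ / (alpha n L δ + δ)) = 1 := by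
    field_simp
  calc (alpha n L δ / (alpha n L δ + δ)) ^ 2
      = ((1 - 1 / (n : ℝ) * (alpha n L δ + δ) / (alpha n L δ + L + δ))
        * (1 + δ / alpha n L δ) ^ 2) * (alpha n L δ / (alpha n L δ + δ)) ^ 2 := by
        rw [h, one_mul]
    _ = (1 - 1 / (n : ℝ) * (alpha n L δ + δ) / (alpha n L δ + L + δ))
        * ((1 + δ / alpha n L δ) * (alpha n L δ / (alpha n L δ + δ))) ^ 2 := by ring
    _ = _ := by rw [h1]; ring

/-- This puts all coefficients of the `y` step over the common denominator `α + L + δ`. -/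
theorem tauZ_eq (hn : 0 < n) (hL : 0 < L) (hδ : 0 < δ) :
    tauZ n L δ = 1 / (alpha n L δ + L + δ) := by
  have hα := alpha_pos hn hL hδ
  have h1 : alpha n L δ + L + δ ≠ 0 := by positivity
  unfold tauZ tauX
  rw [show alpha n L δ + L + δ = alpha n L δ + δ + L by ring] at *
  field_simp
  ring

/-- The equation for `α` turns the algorithm's constant into the one that the initial potential
produces. -/
theorem CIDC_eq (hn : 0 < n) (hL : 0 < L) (hδ : 0 < δ) :
    CIDC n L δ = L ^ 2 + L * (1 / (n : ℝ)) * (alpha n L δ + δ) ^ 2 / (alpha n L δ + L + δ) := by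
  have hα := alpha_pos hn hL hδ
  have hn1 : (1 : ℝ) ≤ n := by exact_mod_cast hn
  have hρ := contraction_eq hn hL hδ
  unfold CIDC
  set α := alpha n L δ
  have hp : 0 ≤ 1 - 1 / (n : ℝ) := by
    rw [sub_nonneg]
    exact div_le_one_of_le₀ hn1 (by positivity)
  have hq : 0 < L + (1 - 1 / (n : ℝ)) * (α + δ) := by positivity
  have hr : 0 < α + L + δ := by positivity
  have h1 : α ^ 2 * (α + L + δ) = (α + δ) ^ 2 * (L + (1 - 1 / (n : ℝ)) * (α + δ)) := by
    rw [div_pow, div_eq_iff (by positivity)] at hρ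
    rw [hρ]
    field_simp
    ring
  congr 1
  rw [div_eq_div_iff hq.ne' hr.ne']
  linear_combination L * (1 / (n : ℝ)) * h1

end Parameters

/-! ### Expected decrease of the potential in one inner iteration -/

/-- One inner iteration, driven by the index `w.1` and the coin `w.2`. -/
def innerStep {d n : ℕ} (f : Fin n → E d → ℝ) (L : ℝ) (x₀ : E d) (δ : ℝ) (s : E d × E d)
    (w : Fin n × Bool) : E d × E d :=
  (proxStep (alpha n L δ) δ (estimator f x₀ δ w.1 (yStep f L x₀ δ s.1 s.2) s.2) s.1
    (yStep f L x₀ δ s.1 s.2), if w.2 then yStep f L x₀ δ s.1 s.2 else s.2)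

/-- The Lyapunov function of the inner loop, for the minimizer `c` of the regularized objective. -/
def potential {d n : ℕ} (f : Fin n → E d → ℝ) (L δ : ℝ) (c : E d) (s : E d × E d) : ℝ :=
  (alpha n L δ + δ) ^ 2 * ‖s.1 - c‖ ^ 2
    + 2 * n * (alpha n L δ + L + δ) * bregman (avg f) c s.2

section OneStep

variable {d n : ℕ} {L δ : ℝ} {f : Fin n → E d → ℝ} {x₀ c : E d}

/-- Stationarity of `c` replaces `δx₀` by `δc + ∇f(c)`; the terms in `δx̃` cancel, and the remaining
`-δ(z - c)` lowers the weight of `z - c` from `α + δ` to `α`. -/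
theorem yStep_eq (hn : 0 < n) (hL : 0 < L) (hδ : 0 < δ) (hf : ∀ j, IsConvexSmooth L (f j))
    (hc : gradient (avg f) c + δ • (c - x₀) = 0) (z xt : E d) :
    (alpha n L δ + L + δ) • (yStep f L x₀ δ z xt - c) =
      alpha n L δ • (z - c) + L • (xt - c) - (gradient (avg f) xt - gradient (avg f) c) := by
  have hα := alpha_pos hn hL hδ
  have hr : alpha n L δ + L + δ ≠ 0 := by positivity
  have hg : gradient (avg f) c = -(δ • (c - x₀)) := eq_neg_of_add_eq_zero_left hc
  have h1 : (alpha n L δ + L + δ) * tauX n L δ = alpha n L δ + δ := by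
    unfold tauX
    field_simp
  have h2 : (alpha n L δ + L + δ) * tauZ n L δ = 1 := by
    rw [tauZ_eq hn hL hδ]
    field_simp
  rw [yStep, fullGrad_eq hn fun j => (hf j).differentiable, hg]
  set α := alpha n L δ
  set r := α + L + δ with hr'
  have h3 : r * (1 - tauX n L δ) = L := by rw [mul_sub, h1, hr']; ring
  rw [smul_sub, smul_add, smul_add, smul_smul, smul_smul, smul_smul, h1, h2, h3, hr']
  module

/-- The term `δy` of the proximal step cancels the regularization part of the gradient at `y`. -/
theorem proxStep_estimator_eq (hn : 0 < n) (hL : 0 < L) (hδ : 0 < δ)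
    (hf : ∀ j, IsConvexSmooth L (f j)) (hc : gradient (avg f) c + δ • (c - x₀) = 0)
    (j : Fin n) (z y xt : E d) :
    (alpha n L δ + δ) • (proxStep (alpha n L δ) δ (estimator f x₀ δ j y xt) z y - c) =
      (alpha n L δ • (z - c) - (gradient (avg f) xt - gradient (avg f) c))
        - (gradient (f j) y - gradient (f j) xt) := by
  have hα := alpha_pos hn hL hδ
  have hr : alpha n L δ + δ ≠ 0 := by positivity
  have hg : gradient (avg f) c = -(δ • (c - x₀)) := eq_neg_of_add_eq_zero_left hc
  rw [smul_sub, proxStep, smul_smul, mul_inv_cancel₀ hr, one_smul, estimator,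
    fullGrad_eq hn fun j => (hf j).differentiable, gradient_reg (hf j).differentiable,
    gradient_reg (hf j).differentiable, hg]
  module

/-- The variance of the estimator is controlled by the Bregman divergence between the points. -/
theorem mean_norm_gradient_sub_sq_le (hn : 0 < n) (hL : 0 < L) (hf : ∀ j, IsConvexSmooth L (f j))
    (x y : E d) :
    1 / (n : ℝ) * ∑ j, ‖gradient (f j) y - gradient (f j) x‖ ^ 2
      ≤ 2 * L * (avg f x - avg f y - inner ℝ (gradient (avg f) y) (x - y)) := by
  have h1 : ∀ j ∈ Finset.univ, ‖gradient (f j) y - gradient (f j) x‖ ^ 2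
      ≤ 2 * L * (f j x - f j y - inner ℝ (gradient (f j) y) (x - y)) := fun j _ => by
    rw [norm_sub_rev]
    exact (hf j).cocoercive hL y x
  have h2 := mul_le_mul_of_nonneg_left (Finset.sum_le_sum h1)
    (by positivity : (0 : ℝ) ≤ 1 / n)
  refine h2.trans_eq ?_
  rw [gradient_avg fun j => (hf j).differentiable, inner_smul_left, sum_inner, ← Finset.mul_sum,
    Finset.sum_sub_distrib, Finset.sum_sub_distrib]
  simp only [avg, RCLike.conj_to_real]
  ring

/-- With `w = α(z - c) - g`, the squared distance is `‖w - (∇f_j(y) - ∇f_j(x̃))‖²`. In the mean its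
cross term is evaluated through `w = (α+L+δ)(y - c) - L(x̃ - c)`. The inner products with `x̃ - c`
cancel against those in the variance bound, leaving `-2(α+δ)⟨G, y - c⟩`, which convexity bounds by a
Bregman divergence. -/
theorem mean_sq_dist_proxStep_le (hn : 0 < n) (hL : 0 < L) (hδ : 0 < δ)
    (hf : ∀ j, IsConvexSmooth L (f j)) (hc : gradient (avg f) c + δ • (c - x₀) = 0)
    (z xt : E d) :
    1 / (n : ℝ) * ∑ j, (alpha n L δ + δ) ^ 2 * ‖proxStep (alpha n L δ) δ
        (estimator f x₀ δ j (yStep f L x₀ δ z xt) xt) z (yStep f L x₀ δ z xt) - c‖ ^ 2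
      + 2 * (alpha n L δ + L + δ) * bregman (avg f) c (yStep f L x₀ δ z xt)
      ≤ alpha n L δ ^ 2 * ‖z - c‖ ^ 2 + 2 * L * bregman (avg f) c xt := by
  have hα := alpha_pos hn hL hδ
  have hn' : (n : ℝ) ≠ 0 := by exact_mod_cast hn.ne'
  have hF := isConvexSmooth_avg hn hf
  have hy := yStep_eq hn hL hδ hf hc z xt
  have hz := fun j => proxStep_estimator_eq hn hL hδ hf hc j z (yStep f L x₀ δ z xt) xt
  have hvar := mean_norm_gradient_sub_sq_le hn hL hf xt (yStep f L x₀ δ z xt)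
  have hmean : 1 / (n : ℝ) * ∑ j, inner ℝ
      (alpha n L δ • (z - c) - (gradient (avg f) xt - gradient (avg f) c))
      (gradient (f j) (yStep f L x₀ δ z xt) - gradient (f j) xt)
      = inner ℝ (alpha n L δ • (z - c) - (gradient (avg f) xt - gradient (avg f) c))
        (gradient (avg f) (yStep f L x₀ δ z xt) - gradient (avg f) xt) := by
    rw [← inner_sum, ← inner_smul_right, Finset.sum_sub_distrib, smul_sub (1 / (n : ℝ)),
      ← gradient_avg fun j => (hf j).differentiable, ← gradient_avg fun j => (hf j).differentiable]
  have hconv := hF.bregman_le_inner c (yStep f L x₀ δ z xt)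
  set α := alpha n L δ
  set y := yStep f L x₀ δ z xt
  set g := gradient (avg f) xt - gradient (avg f) c with hg
  set w := α • (z - c) - g with hw
  have hsq : ∀ j, (α + δ) ^ 2 * ‖proxStep α δ (estimator f x₀ δ j y xt) z y - c‖ ^ 2
      = ‖w‖ ^ 2 - 2 * inner ℝ w (gradient (f j) y - gradient (f j) xt)
        + ‖gradient (f j) y - gradient (f j) xt‖ ^ 2 := fun j => by
    rw [← norm_sub_sq_real, ← hz j, norm_smul, mul_pow, Real.norm_eq_abs, sq_abs]
  have hsum : 1 / (n : ℝ) * ∑ j, (α + δ) ^ 2 * ‖proxStep α δ (estimator f x₀ δ j y xt) z y - c‖ ^ 2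
      = ‖w‖ ^ 2 - 2 * inner ℝ w (gradient (avg f) y - gradient (avg f) xt)
        + 1 / (n : ℝ) * ∑ j, ‖gradient (f j) y - gradient (f j) xt‖ ^ 2 := by
    simp_rw [hsq]
    rw [← hmean, Finset.sum_add_distrib, Finset.sum_sub_distrib, ← Finset.mul_sum,
      Finset.sum_const, Finset.card_univ, Fintype.card_fin, nsmul_eq_mul]
    field_simp
  have hwg : ‖w‖ ^ 2 + 2 * inner ℝ w g = α ^ 2 * ‖z - c‖ ^ 2 - ‖g‖ ^ 2 := by
    have h1 : ‖w + g‖ ^ 2 = α ^ 2 * ‖z - c‖ ^ 2 := by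
      rw [hw, sub_add_cancel, norm_smul, mul_pow, Real.norm_eq_abs, sq_abs]
    rw [norm_add_sq_real] at h1
    linarith
  have hwy : w = (α + L + δ) • (y - c) - L • (xt - c) := by rw [hy, hw]; abel
  set G := gradient (avg f) y - gradient (avg f) c with hG
  have e1 : gradient (avg f) y - gradient (avg f) xt = G - g := by rw [hG, hg]; abel
  have hwG : inner ℝ w G = (α + L + δ) * inner ℝ G (y - c) - L * inner ℝ G (xt - c) := by
    rw [hwy, inner_sub_left, inner_smul_left, inner_smul_left, real_inner_comm G, real_inner_comm G]
    simp
  have hB : avg f xt - avg f y - inner ℝ (gradient (avg f) y) (xt - y)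
      = bregman (avg f) c xt - bregman (avg f) c y
        - (inner ℝ G (xt - c) - inner ℝ G (y - c)) := by
    rw [← inner_sub_right, sub_sub_sub_cancel_right, hG, inner_sub_left]
    unfold bregman
    have : inner ℝ (gradient (avg f) c) (xt - y) = inner ℝ (gradient (avg f) c) (xt - c)
        - inner ℝ (gradient (avg f) c) (y - c) := by
      rw [← inner_sub_right, sub_sub_sub_cancel_right]
    rw [this]
    ring
  rw [hsum, e1, inner_sub_right, hwG]
  rw [hB] at hvar
  have h5 := mul_le_mul_of_nonneg_left hconv (by positivity : 0 ≤ 2 * (α + δ))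
  -- The leftover `-‖g‖²` is discarded.
  nlinarith [sq_nonneg ‖g‖]

/-- The weight `2n(α+L+δ)` is chosen so that the coin, of probability `1/n`, yields exactly the
Bregman term at `y` controlled by `mean_sq_dist_proxStep_le`. Writing `ρ` for the contraction
factor, `ρ(α+δ)² = α²` handles the distance term, and `2n(α+L+δ)(ρ - 1 + 1/n) = 2L` the Bregman term
at `x̃`. -/
theorem mean_potential_innerStep_le (hn : 0 < n) (hL : 0 < L) (hδ : 0 < δ)
    (hf : ∀ j, IsConvexSmooth L (f j)) (hc : gradient (avg f) c + δ • (c - x₀) = 0)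
    (s : E d × E d) :
    1 / (n : ℝ) * ∑ j, (1 / (n : ℝ) * potential f L δ c (innerStep f L x₀ δ s (j, true))
        + (1 - 1 / (n : ℝ)) * potential f L δ c (innerStep f L x₀ δ s (j, false)))
      ≤ (alpha n L δ / (alpha n L δ + δ)) ^ 2 * potential f L δ c s := by
  have hα := alpha_pos hn hL hδ
  have hn' : (n : ℝ) ≠ 0 := by exact_mod_cast hn.ne'
  have h := mean_sq_dist_proxStep_le hn hL hδ hf hc s.1 s.2
  have hρ := contraction_eq hn hL hδ
  have e : ∀ j, 1 / (n : ℝ) * potential f L δ c (innerStep f L x₀ δ s (j, true))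
        + (1 - 1 / (n : ℝ)) * potential f L δ c (innerStep f L x₀ δ s (j, false))
      = (alpha n L δ + δ) ^ 2 * ‖proxStep (alpha n L δ) δ
          (estimator f x₀ δ j (yStep f L x₀ δ s.1 s.2) s.2) s.1 (yStep f L x₀ δ s.1 s.2) - c‖ ^ 2
        + (2 * (alpha n L δ + L + δ) * bregman (avg f) c (yStep f L x₀ δ s.1 s.2)
          + 2 * (n - 1) * (alpha n L δ + L + δ) * bregman (avg f) c s.2) := fun j => by
    simp only [potential, innerStep, if_true, Bool.false_eq_true, if_false]
    field_simp
    ring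
  simp_rw [e]
  rw [Finset.sum_add_distrib, mul_add, Finset.sum_const, Finset.card_univ, Fintype.card_fin,
    nsmul_eq_mul, ← mul_assoc (1 / (n : ℝ)) (n : ℝ), one_div_mul_cancel hn', one_mul, potential,
    mul_add (_ ^ 2)]
  have e1 : (alpha n L δ / (alpha n L δ + δ)) ^ 2 * ((alpha n L δ + δ) ^ 2 * ‖s.1 - c‖ ^ 2)
      = alpha n L δ ^ 2 * ‖s.1 - c‖ ^ 2 := by
    field_simp
  have e2 : (alpha n L δ / (alpha n L δ + δ)) ^ 2
      * (2 * n * (alpha n L δ + L + δ) * bregman (avg f) c s.2)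
      = 2 * L * bregman (avg f) c s.2
        + 2 * (n - 1) * (alpha n L δ + L + δ) * bregman (avg f) c s.2 := by
    have hr : alpha n L δ + L + δ ≠ 0 := by positivity
    rw [hρ]
    field_simp
    ring
  rw [e1, e2]
  linarith

/-- The prefactor normalizes the Bregman part to `2L` times the divergence, which cocoercivity
needs; the distance part is dropped. -/
theorem norm_gradient_sub_sq_le_potential (hn : 0 < n) (hL : 0 < L) (hδ : 0 < δ)
    (hf : ∀ j, IsConvexSmooth L (f j)) (s : E d × E d) :
    ‖gradient (avg f) s.2 - gradient (avg f) c‖ ^ 2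
      ≤ L / (n * (alpha n L δ + L + δ)) * potential f L δ c s := by
  have hα := alpha_pos hn hL hδ
  have hn' : (0 : ℝ) < n := by exact_mod_cast hn
  refine ((isConvexSmooth_avg hn hf).norm_gradient_sub_sq_le hL c s.2).trans ?_
  have e : L / (n * (alpha n L δ + L + δ)) * potential f L δ c s
      = L / (n * (alpha n L δ + L + δ)) * ((alpha n L δ + δ) ^ 2 * ‖s.1 - c‖ ^ 2)
        + 2 * L * bregman (avg f) c s.2 := by
    have hr : alpha n L δ + L + δ ≠ 0 := by positivity
    unfold potential
    field_simp
  rw [e]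
  exact le_add_of_nonneg_left (by positivity)

/-- The term `L²` of the constant comes from the Bregman part, the other term from the distance
part. -/
theorem potential_start_le (hn : 0 < n) (hL : 0 < L) (hδ : 0 < δ)
    (hf : ∀ j, IsConvexSmooth L (f j)) :
    L / (n * (alpha n L δ + L + δ)) * potential f L δ c (x₀, x₀) ≤ CIDC n L δ * ‖x₀ - c‖ ^ 2 := by
  have hα := alpha_pos hn hL hδ
  have hn' : (0 : ℝ) < n := by exact_mod_cast hn
  have hr : 0 < alpha n L δ + L + δ := by positivity
  have e : L / (n * (alpha n L δ + L + δ)) * potential f L δ c (x₀, x₀)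
      = L * (1 / (n : ℝ)) * (alpha n L δ + δ) ^ 2 / (alpha n L δ + L + δ) * ‖x₀ - c‖ ^ 2
        + 2 * L * bregman (avg f) c x₀ := by
    unfold potential
    field_simp
  have h := mul_le_mul_of_nonneg_left ((isConvexSmooth_avg hn hf).bregman_le c x₀)
    (by positivity : 0 ≤ 2 * L)
  rw [e, CIDC_eq hn hL hδ]
  linarith

end OneStep

/-! ### Functions of finitely many independent samples -/

section FiniteHistory

variable {ι β γ : Type*} {X : (ι → β) → γ} {S : Finset ι}

/-- Factoring through finitely many finite-valued samples makes measurability and integrability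
automatic. -/
theorem exists_factor_of_dependsOn [Nonempty γ] (hX : DependsOn X (S : Set ι)) :
    ∃ X' : (S → β) → γ, ∀ w, X w = X' fun s => w s := by
  have hf : Function.FactorsThrough X (fun (w : ι → β) (s : S) => w s) := fun u v huv =>
    hX fun s hs => congrFun huv ⟨s, hs⟩
  exact ⟨Function.extend (fun (w : ι → β) (s : S) => w s) X fun _ => Classical.arbitrary γ,
    fun w => (hf.extend_apply _ w).symm⟩

variable [Finite β] [MeasurableSpace β] [MeasurableSingletonClass β]
  {Ω : Type*} [MeasurableSpace Ω] {μ : Measure Ω} {W : Ω → ι → β}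

theorem measurable_of_dependsOn [MeasurableSpace γ] [Nonempty γ] (hX : DependsOn X (S : Set ι))
    (hW : ∀ s, Measurable fun ω => W ω s) : Measurable fun ω => X (W ω) := by
  obtain ⟨X', hX'⟩ := exists_factor_of_dependsOn hX
  simp_rw [hX']
  exact (measurable_of_finite X').comp (measurable_pi_lambda _ fun s => hW s)

theorem integrable_of_dependsOn [IsFiniteMeasure μ] {X : (ι → β) → ℝ}
    (hX : DependsOn X (S : Set ι)) (hW : ∀ s, Measurable fun ω => W ω s) :
    Integrable (fun ω => X (W ω)) μ := by
  obtain ⟨X', hX'⟩ := exists_factor_of_dependsOn hX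
  have hm : Measurable fun ω (s : S) => W ω s := measurable_pi_lambda _ fun s => hW s
  simp_rw [hX']
  exact (Integrable.of_finite (f := X') (μ := μ.map _)).comp_measurable hm

theorem indepFun_of_dependsOn {γ' : Type*} [MeasurableSpace γ] [Nonempty γ] [MeasurableSpace γ']
    [Nonempty γ'] {Y : (ι → β) → γ'} {T : Finset ι} (hX : DependsOn X (S : Set ι))
    (hY : DependsOn Y (T : Set ι)) (hST : Disjoint S T)
    (hW : ∀ s, Measurable fun ω => W ω s) (hind : iIndepFun (fun s ω => W ω s) μ) :
    IndepFun (fun ω => X (W ω)) (fun ω => Y (W ω)) μ := by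
  obtain ⟨X', hX'⟩ := exists_factor_of_dependsOn hX
  obtain ⟨Y', hY'⟩ := exists_factor_of_dependsOn hY
  simp_rw [hX', hY']
  exact (hind.indepFun_finset S T hST hW).comp (measurable_of_finite X') (measurable_of_finite Y')

/-- Fubini on the product law of a history `h` and a fresh sample `v` plays the role of conditional
expectation. -/
theorem integral_le_of_indepFun_fintype {H V : Type*} [Finite H] [Fintype V]
    [MeasurableSpace H] [MeasurableSingletonClass H] [MeasurableSpace V]
    [MeasurableSingletonClass V] [IsProbabilityMeasure μ] {h : Ω → H} {v : Ω → V}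
    (hh : Measurable h) (hv : Measurable v) (hind : IndepFun h v μ) {g : H → V → ℝ} {G : H → ℝ}
    (hg : ∀ a, ∑ c, μ.real (v ⁻¹' {c}) * g a c ≤ G a) :
    ∫ ω, g (h ω) (v ω) ∂μ ≤ ∫ ω, G (h ω) ∂μ := by
  have := Measure.isProbabilityMeasure_map (μ := μ) hh.aemeasurable
  have := Measure.isProbabilityMeasure_map (μ := μ) hv.aemeasurable
  have e1 : ∫ ω, g (h ω) (v ω) ∂μ
      = ∫ z, Function.uncurry g z ∂((μ.map h).prod (μ.map v)) := by
    rw [← hind.map_prod_eq_prod_map_map hh.aemeasurable hv.aemeasurable,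
      integral_map (hh.prodMk hv).aemeasurable (measurable_of_finite _).aestronglyMeasurable]
    rfl
  have e2 : ∫ ω, G (h ω) ∂μ = ∫ a, G a ∂(μ.map h) :=
    (integral_map hh.aemeasurable (measurable_of_finite G).aestronglyMeasurable).symm
  rw [e1, e2, integral_prod _ Integrable.of_finite]
  refine integral_mono Integrable.of_finite Integrable.of_finite fun a => ?_
  rw [integral_fintype Integrable.of_finite]
  refine le_of_eq_of_le (Finset.sum_congr rfl fun c _ => ?_) (hg a)
  rw [map_measureReal_apply hv (measurableSet_singleton c), smul_eq_mul]
  rfl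

end FiniteHistory

/-! ### The inner loop as a function of the samples -/

section InnerLoop

variable {d n : ℕ} {L ε δ : ℝ} {f : Fin n → E d → ℝ} {x₀ c : E d}

theorem innerState_congr {i i' : ℕ → Fin n} {b b' : ℕ → Bool} {k : ℕ}
    (hi : ∀ j < k, i j = i' j) (hb : ∀ j < k, b j = b' j) :
    innerState f L x₀ δ i b k = innerState f L x₀ δ i' b' k := by
  induction k with
  | zero => rfl
  | succ k ih =>
    simp only [innerState]
    rw [ih (fun j hj => hi j (hj.trans k.lt_succ_self)) fun j hj => hb j (hj.trans k.lt_succ_self),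
      hi k k.lt_succ_self, hb k k.lt_succ_self]

/-- The number of the inner iteration at which the inner loop is broken at the latest. -/
def breakIndex (n : ℕ) (L δ : ℝ) : ℕ := sInf {k | BreakTest n L δ k}

theorem breakTest_breakIndex (hn : 0 < n) (hL : 0 < L) (hδ : 0 < δ) :
    BreakTest n L δ (breakIndex n L δ) := by
  have hα := alpha_pos hn hL hδ
  have h1 : 1 < 1 + δ / alpha n L δ := lt_add_of_pos_right _ (by positivity)
  obtain ⟨k, hk⟩ := pow_unbounded_of_one_lt (Real.sqrt (CIDC n L δ) / δ) h1
  exact Nat.sInf_mem (s := {k | BreakTest n L δ k}) ⟨k, hk.le⟩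

variable {i : ℕ → Fin n} {b : ℕ → Bool}

theorem le_breakIndex_of_innerReached (hn : 0 < n) (hL : 0 < L) (hδ : 0 < δ) {k : ℕ}
    (hk : InnerReached f L ε x₀ δ i b k) : k ≤ breakIndex n L δ :=
  not_lt.1 fun h => (hk _ h).2 (breakTest_breakIndex hn hL hδ)

/-- No break occurs before `breakIndex`, and there the stop test comes first, so that index is
included. The loop thus becomes an event about the unstopped sequence. -/
theorem loopTerminates_iff (hn : 0 < n) (hL : 0 < L) (hδ : 0 < δ) :
    LoopTerminates f L ε x₀ δ i b ↔
      ∃ k ≤ breakIndex n L δ, StopTest f L ε x₀ δ i b k := by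
  classical
  constructor
  · rintro ⟨k, hk, hs⟩
    exact ⟨k, le_breakIndex_of_innerReached hn hL hδ hk, hs⟩
  · rintro ⟨k, hk, hs⟩
    have hex : ∃ k, StopTest f L ε x₀ δ i b k := ⟨k, hs⟩
    refine ⟨Nat.find hex, fun j hj => ⟨Nat.find_min hex hj, fun hb => ?_⟩, Nat.find_spec hex⟩
    have h1 : breakIndex n L δ ≤ j := Nat.sInf_le hb
    have h2 : Nat.find hex ≤ k := Nat.find_min' hex hs
    omega

theorem loopBreaks_iff (hn : 0 < n) (hL : 0 < L) (hδ : 0 < δ) :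
    LoopBreaks f L ε x₀ δ i b ↔ ¬ LoopTerminates f L ε x₀ δ i b := by
  rw [loopTerminates_iff hn hL hδ]
  push Not
  constructor
  · rintro ⟨k, hk, hs, hb⟩ j hj
    have h1 : breakIndex n L δ ≤ k := Nat.sInf_le hb
    rcases (hj.trans h1).lt_or_eq with h | rfl
    · exact (hk j h).1
    · exact hs
  · intro h
    refine ⟨breakIndex n L δ, fun j hj => ⟨h j hj.le, fun hb => ?_⟩, h _ le_rfl,
      breakTest_breakIndex hn hL hδ⟩
    exact (Nat.sInf_le hb : breakIndex n L δ ≤ j).not_gt hj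

end InnerLoop

/-! ### Dependence on the samples, and expectation and probability bounds -/

/-- The samples that the first `k` inner iterations of outer iteration `t` use. -/
def history (t k : ℕ) : Finset (ℕ × ℕ) := {t} ×ˢ Finset.range k

section Sampling

variable {d n : ℕ} {L ε δ β : ℝ} {f : Fin n → E d → ℝ} {x₀ c : E d}

theorem dependsOn_innerState (t k : ℕ) :
    DependsOn (fun w : ℕ × ℕ → Fin n × Bool =>
      innerState f L x₀ δ (fun j => (w (t, j)).1) (fun j => (w (t, j)).2) k)
      (history t k : Set (ℕ × ℕ)) := fun u v huv => by
  have h : ∀ j < k, u (t, j) = v (t, j) := fun j hj => huv (t, j) (by simp [history, hj])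
  exact innerState_congr (fun j hj => by rw [h j hj]) fun j hj => by rw [h j hj]

theorem dependsOn_loopTerminates (hn : 0 < n) (hL : 0 < L) (hδ : 0 < δ) (t : ℕ) :
    DependsOn (fun w : ℕ × ℕ → Fin n × Bool =>
      LoopTerminates f L ε x₀ δ (fun j => (w (t, j)).1) (fun j => (w (t, j)).2))
      (history t (breakIndex n L δ) : Set (ℕ × ℕ)) := fun u v huv => by
  simp only [loopTerminates_iff hn hL hδ, StopTest]
  refine propext (exists_congr fun k => and_congr_right fun hk => ?_)
  have := dependsOn_innerState (f := f) (L := L) (x₀ := x₀) (δ := δ) t k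
    (x := u) (y := v) fun s hs => huv s (by
      simp only [history, Finset.coe_product, Finset.coe_singleton, Finset.coe_range,
        Set.mem_prod, Set.mem_singleton_iff, Set.mem_Iio] at hs ⊢
      exact ⟨hs.1, hs.2.trans_le hk⟩)
  simp only at this
  rw [this]

theorem delta_eq (L β : ℝ) (t : ℕ) : delta L β t = L / β ^ t := by
  induction t with
  | zero => simp [delta]
  | succ t ih => rw [delta, ih, pow_succ, div_div]

theorem delta_pos (hL : 0 < L) (hβ : 1 < β) (t : ℕ) : 0 < delta L β t := by
  rw [delta_eq]
  positivity

theorem dependsOn_outerReached (hn : 0 < n) (hL : 0 < L) (hβ : 1 < β) (l : ℕ) :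
    DependsOn (fun w : ℕ × ℕ → Fin n × Bool =>
      OuterReached f L ε β x₀ (fun t k => (w (t, k)).1) (fun t k => (w (t, k)).2) l)
      (((Finset.range l).biUnion fun s => history s (breakIndex n L (delta L β s)) :
        Finset (ℕ × ℕ)) : Set (ℕ × ℕ)) := fun u v huv => by
  refine propext (forall_congr' fun s => forall_congr' fun hs => ?_)
  rw [loopBreaks_iff hn hL (delta_pos hL hβ s), loopBreaks_iff hn hL (delta_pos hL hβ s)]
  refine not_congr (iff_of_eq ?_)
  refine dependsOn_loopTerminates hn hL (delta_pos hL hβ s) s fun r hr => huv r ?_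
  rw [Finset.coe_biUnion]
  exact Set.mem_biUnion (Finset.mem_coe.2 (Finset.mem_range.2 hs)) hr

variable {Ω : Type*} [MeasurableSpace Ω] {μ : Measure Ω} {i : ℕ → ℕ → Ω → Fin n}
  {b : ℕ → ℕ → Ω → Bool}

/-- All samples, indexed by outer and inner iteration. -/
def samples (i : ℕ → ℕ → Ω → Fin n) (b : ℕ → ℕ → Ω → Bool) (ω : Ω) (s : ℕ × ℕ) : Fin n × Bool :=
  (i s.1 s.2 ω, b s.1 s.2 ω)

namespace IsSampling

theorem measurable_samples (h : IsSampling μ i b) (s : ℕ × ℕ) :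
    Measurable fun ω => samples i b ω s :=
  (h.measurable_index s.1 s.2).prodMk (h.measurable_coin s.1 s.2)

theorem coin_false [IsProbabilityMeasure μ] (h : IsSampling μ i b) (t k : ℕ) :
    μ.real {ω | b t k ω = false} = 1 - 1 / (n : ℝ) := by
  have hm : MeasurableSet {ω | b t k ω = true} :=
    h.measurable_coin t k (measurableSet_singleton true)
  rw [← h.coin t k, ← probReal_compl_eq_one_sub hm]
  congr 1
  ext ω
  simp

theorem law_samples [IsProbabilityMeasure μ] (h : IsSampling μ i b) (s : ℕ × ℕ) (j : Fin n)
    (c : Bool) :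
    μ.real ((fun ω => samples i b ω s) ⁻¹' {(j, c)})
      = 1 / (n : ℝ) * if c then 1 / (n : ℝ) else 1 - 1 / (n : ℝ) := by
  have e : (fun ω => samples i b ω s) ⁻¹' {(j, c)}
      = i s.1 s.2 ⁻¹' {j} ∩ b s.1 s.2 ⁻¹' {c} := by
    ext ω
    simp [samples]
  have h1 := (h.indep_index_coin s.1 s.2).measure_inter_preimage_eq_mul {j} {c}
    (measurableSet_singleton j) (measurableSet_singleton c)
  rw [e, measureReal_def, h1, ENNReal.toReal_mul]
  refine congrArg₂ _ (h.uniform s.1 s.2 j) ?_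
  cases c
  · exact h.coin_false s.1 s.2
  · exact h.coin s.1 s.2

variable [IsProbabilityMeasure μ]

/-- State `k` depends only on earlier samples, so sample `(t, k)` is independent of it and the
one-step bound iterates. -/
theorem integral_potential_le (h : IsSampling μ i b) (hn : 0 < n) (hL : 0 < L) (hδ : 0 < δ)
    (hf : ∀ j, IsConvexSmooth L (f j)) (hc : gradient (avg f) c + δ • (c - x₀) = 0) (t k : ℕ) :
    ∫ ω, potential f L δ c (innerState f L x₀ δ (fun j => i t j ω) (fun j => b t j ω) k) ∂μ
      ≤ ((alpha n L δ / (alpha n L δ + δ)) ^ 2) ^ k * potential f L δ c (x₀, x₀) := by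
  induction k with
  | zero => simp [innerState]
  | succ k ih =>
    obtain ⟨S, hS⟩ := exists_factor_of_dependsOn
      (dependsOn_innerState (n := n) (f := f) (L := L) (x₀ := x₀) (δ := δ) t k)
    have hS' : ∀ ω, innerState f L x₀ δ (fun j => i t j ω) (fun j => b t j ω) k
        = S fun s => samples i b ω s := fun ω => hS (samples i b ω)
    have hm : Measurable fun ω (s : history t k) => samples i b ω s :=
      measurable_pi_lambda _ fun s => h.measurable_samples s
    have hdisj : Disjoint (history t k) {(t, k)} := by simp [history]
    have hind : IndepFun (fun ω (s : history t k) => samples i b ω s)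
        (fun ω => samples i b ω (t, k)) μ :=
      (h.indep.indepFun_finset _ _ hdisj h.measurable_samples).comp measurable_id
        (measurable_pi_apply (⟨(t, k), Finset.mem_singleton_self _⟩ : ({(t, k)} : Finset (ℕ × ℕ))))
    have hstep := integral_le_of_indepFun_fintype hm (h.measurable_samples (t, k)) hind
      (g := fun a w => potential f L δ c (innerStep f L x₀ δ (S a) w))
      (G := fun a => (alpha n L δ / (alpha n L δ + δ)) ^ 2 * potential f L δ c (S a)) (fun a => by
        refine le_of_eq_of_le ?_ (mean_potential_innerStep_le hn hL hδ hf hc (S a))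
        simp_rw [Fintype.sum_prod_type, h.law_samples, Fintype.sum_bool, if_true,
          Bool.false_eq_true, if_false, Finset.mul_sum]
        exact Finset.sum_congr rfl fun j _ => by ring)
    have e : ∀ ω, innerState f L x₀ δ (fun j => i t j ω) (fun j => b t j ω) (k + 1)
        = innerStep f L x₀ δ (S fun s => samples i b ω s) (samples i b ω (t, k)) := fun ω => by
      rw [← hS' ω]
      rfl
    simp_rw [e]
    refine hstep.trans ?_
    rw [integral_const_mul, pow_succ' _ k, mul_assoc]
    refine mul_le_mul_of_nonneg_left ?_ (by positivity)
    simpa only [hS'] using ih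

/-- At the iteration in which the inner loop is broken at the latest, the expected gradient norm is
at most `2 δ R`. -/
theorem integral_norm_gradient_le (h : IsSampling μ i b) (hn : 0 < n) (hL : 0 < L) (hδ : 0 < δ)
    (hf : ∀ j, IsConvexSmooth L (f j)) {xs : E d} (hxs : IsMinOn (avg f) Set.univ xs)
    {R : ℝ} (hR : 0 < R) (hxR : ‖x₀ - xs‖ ≤ R) (t : ℕ) :
    ∫ ω, ‖gradient (avg f) (innerState f L x₀ δ (fun j => i t j ω) (fun j => b t j ω)
      (breakIndex n L δ)).2‖ ∂μ ≤ 2 * (δ * R) := by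
  obtain ⟨c, hc, hcR⟩ := exists_regularized_minimizer (isConvexSmooth_avg hn hf) hδ hxs
  have hα := alpha_pos hn hL hδ
  have hn' : (0 : ℝ) < n := by exact_mod_cast hn
  set K := breakIndex n L δ with hK
  set Z : Ω → E d × E d :=
    fun ω => innerState f L x₀ δ (fun j => i t j ω) (fun j => b t j ω) K with hZ
  have hint : ∀ φ : E d × E d → ℝ, Integrable (fun ω => φ (Z ω)) μ := fun φ =>
    integrable_of_dependsOn (X := fun w => φ (innerState f L x₀ δ (fun j => (w (t, j)).1)
      (fun j => (w (t, j)).2) K)) (W := samples i b)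
      (fun u v huv => congrArg φ (dependsOn_innerState t K huv)) h.measurable_samples
  have hcR' : ‖x₀ - c‖ ≤ R := hcR.trans hxR
  have hgc : ‖gradient (avg f) c‖ ≤ δ * R := by
    rw [eq_neg_of_add_eq_zero_left hc, norm_neg, norm_smul, Real.norm_of_nonneg hδ.le, norm_sub_rev]
    exact mul_le_mul_of_nonneg_left hcR' hδ.le
  have hCnn : 0 ≤ CIDC n L δ := by
    rw [CIDC_eq hn hL hδ]
    positivity
  -- The squared break test, since `α/(α+δ)` is the inverse of `1 + δ/α`.
  have hbreak : ((alpha n L δ / (alpha n L δ + δ)) ^ 2) ^ K * CIDC n L δ ≤ δ ^ 2 := by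
    have h1 : Real.sqrt (CIDC n L δ) ≤ δ * (1 + δ / alpha n L δ) ^ K := by
      have := breakTest_breakIndex hn hL hδ
      rw [BreakTest, div_le_iff₀ hδ] at this
      linarith
    have h2 : CIDC n L δ ≤ (δ * (1 + δ / alpha n L δ) ^ K) ^ 2 := by
      rw [← Real.sq_sqrt hCnn]
      exact pow_le_pow_left₀ (Real.sqrt_nonneg _) h1 2
    have h3 : alpha n L δ / (alpha n L δ + δ) * (1 + δ / alpha n L δ) = 1 := by field_simp
    have hring : ∀ u v : ℝ, (u ^ 2) ^ K * (δ * v ^ K) ^ 2 = δ ^ 2 * ((u * v) ^ K) ^ 2 :=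
      fun u v => by ring
    calc ((alpha n L δ / (alpha n L δ + δ)) ^ 2) ^ K * CIDC n L δ
        ≤ ((alpha n L δ / (alpha n L δ + δ)) ^ 2) ^ K * (δ * (1 + δ / alpha n L δ) ^ K) ^ 2 :=
          mul_le_mul_of_nonneg_left h2 (by positivity)
      _ = δ ^ 2 * ((alpha n L δ / (alpha n L δ + δ) * (1 + δ / alpha n L δ)) ^ K) ^ 2 := hring _ _
      _ = δ ^ 2 := by rw [h3]; simp
  have hsq : ∫ ω, ‖gradient (avg f) (Z ω).2 - gradient (avg f) c‖ ^ 2 ∂μ ≤ (δ * R) ^ 2 := by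
    calc ∫ ω, ‖gradient (avg f) (Z ω).2 - gradient (avg f) c‖ ^ 2 ∂μ
        ≤ ∫ ω, L / (n * (alpha n L δ + L + δ)) * potential f L δ c (Z ω) ∂μ :=
          integral_mono (hint fun s => ‖gradient (avg f) s.2 - gradient (avg f) c‖ ^ 2)
            ((hint _).const_mul _)
            fun ω => norm_gradient_sub_sq_le_potential hn hL hδ hf (Z ω)
      _ = L / (n * (alpha n L δ + L + δ)) * ∫ ω, potential f L δ c (Z ω) ∂μ :=
          integral_const_mul _ _
      _ ≤ L / (n * (alpha n L δ + L + δ)) * (((alpha n L δ / (alpha n L δ + δ)) ^ 2) ^ K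
            * potential f L δ c (x₀, x₀)) :=
          mul_le_mul_of_nonneg_left (h.integral_potential_le hn hL hδ hf hc t K) (by positivity)
      _ = ((alpha n L δ / (alpha n L δ + δ)) ^ 2) ^ K
            * (L / (n * (alpha n L δ + L + δ)) * potential f L δ c (x₀, x₀)) := by ring
      _ ≤ ((alpha n L δ / (alpha n L δ + δ)) ^ 2) ^ K * (CIDC n L δ * ‖x₀ - c‖ ^ 2) :=
          mul_le_mul_of_nonneg_left (potential_start_le hn hL hδ hf) (by positivity)
      _ ≤ δ ^ 2 * R ^ 2 := by
          rw [← mul_assoc]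
          exact mul_le_mul hbreak (pow_le_pow_left₀ (norm_nonneg _) hcR' 2) (by positivity)
            (by positivity)
      _ = (δ * R) ^ 2 := by ring
  have ha : 0 < δ * R := mul_pos hδ hR
  set a := δ * R
  -- The inequality `u ≤ u²/(2a) + a/2` replaces Jensen; after integration the constants add to `1/2
  -- + 3/2 = 2`.
  have hpt : ∀ ω, ‖gradient (avg f) (Z ω).2‖
      ≤ (2 * a)⁻¹ * ‖gradient (avg f) (Z ω).2 - gradient (avg f) c‖ ^ 2 + 3 / 2 * a := fun ω => by
    set u := ‖gradient (avg f) (Z ω).2 - gradient (avg f) c‖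
    have h1 : ‖gradient (avg f) (Z ω).2‖ ≤ u + a :=
      (norm_le_norm_sub_add _ (gradient (avg f) c)).trans (add_le_add_right hgc _)
    have h2 : u ≤ (2 * a)⁻¹ * u ^ 2 + a / 2 := by
      have : (2 * a)⁻¹ * u ^ 2 + a / 2 - u = (2 * a)⁻¹ * (u - a) ^ 2 := by
        field_simp
        ring
      have : 0 ≤ (2 * a)⁻¹ * (u - a) ^ 2 := by positivity
      linarith
    linarith
  calc ∫ ω, ‖gradient (avg f) (Z ω).2‖ ∂μ
      ≤ ∫ ω, ((2 * a)⁻¹ * ‖gradient (avg f) (Z ω).2 - gradient (avg f) c‖ ^ 2 + 3 / 2 * a) ∂μ :=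
        integral_mono (hint fun s => ‖gradient (avg f) s.2‖)
          (((hint fun s => ‖gradient (avg f) s.2 - gradient (avg f) c‖ ^ 2).const_mul _).add
            (integrable_const _)) hpt
    _ = (2 * a)⁻¹ * ∫ ω, ‖gradient (avg f) (Z ω).2 - gradient (avg f) c‖ ^ 2 ∂μ + 3 / 2 * a := by
        rw [integral_add ((hint fun s =>
            ‖gradient (avg f) s.2 - gradient (avg f) c‖ ^ 2).const_mul _) (integrable_const _),
          integral_const_mul]
        simp
    _ ≤ (2 * a)⁻¹ * a ^ 2 + 3 / 2 * a := by gcongr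
    _ = 2 * a := by field_simp; ring

theorem one_sub_le_prob_loopTerminates (h : IsSampling μ i b) (hn : 0 < n) (hL : 0 < L)
    (hδ : 0 < δ) (hε : 0 < ε) (hf : ∀ j, IsConvexSmooth L (f j)) {xs : E d}
    (hxs : IsMinOn (avg f) Set.univ xs) {R : ℝ} (hR : 0 < R) (hxR : ‖x₀ - xs‖ ≤ R)
    {q : ℝ} (hq : δ ≤ ε * q / (2 * R)) (t : ℕ) :
    1 - q ≤ μ.real {ω | LoopTerminates f L ε x₀ δ (fun j => i t j ω) (fun j => b t j ω)} := by
  set K := breakIndex n L δ with hK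
  set Y : Ω → ℝ := fun ω => ‖gradient (avg f) (innerState f L x₀ δ (fun j => i t j ω)
    (fun j => b t j ω) K).2‖ with hY
  have hdep : DependsOn (fun w : ℕ × ℕ → Fin n × Bool => ‖gradient (avg f)
      (innerState f L x₀ δ (fun j => (w (t, j)).1) (fun j => (w (t, j)).2) K).2‖)
      (history t K : Set (ℕ × ℕ)) := fun u v huv =>
    congrArg (fun s : E d × E d => ‖gradient (avg f) s.2‖) (dependsOn_innerState t K huv)
  have hmeas : Measurable Y :=
    measurable_of_dependsOn (W := samples i b) hdep h.measurable_samples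
  have hint : Integrable Y μ :=
    integrable_of_dependsOn (W := samples i b) hdep h.measurable_samples
  have hmarkov := mul_meas_ge_le_integral_of_nonneg
    (Filter.Eventually.of_forall fun ω => norm_nonneg _) hint ε
  have hmean : ∫ ω, Y ω ∂μ ≤ ε * q := by
    refine (h.integral_norm_gradient_le hn hL hδ hf hxs hR hxR t).trans ?_
    rw [le_div_iff₀ (by positivity)] at hq
    linarith
  have hle : μ.real {ω | ε ≤ Y ω} ≤ q := le_of_mul_le_mul_left (hmarkov.trans hmean) hε
  have hcompl : μ.real {ω | ε ≤ Y ω}ᶜ = 1 - μ.real {ω | ε ≤ Y ω} :=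
    probReal_compl_eq_one_sub (measurableSet_le measurable_const hmeas)
  -- Outside Markov's bad event the stop test already holds at the last index.
  have hsub : {ω | ε ≤ Y ω}ᶜ ⊆
      {ω | LoopTerminates f L ε x₀ δ (fun j => i t j ω) (fun j => b t j ω)} := fun ω hω =>
    (loopTerminates_iff hn hL hδ).2 ⟨K, le_rfl, (not_le.1 (show ¬ ε ≤ Y ω from hω)).le⟩
  have := measureReal_mono (μ := μ) hsub
  linarith

end IsSampling

end Sampling

/-! ### The number of inner iterations -/

section Parameters

variable {n : ℕ} {L δ : ℝ}

theorem alpha_add_sq_le (hn : 0 < n) (hL : 0 < L) (hδ : 0 < δ) :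
    (alpha n L δ + δ) ^ 2 ≤ 2 * n * δ * (alpha n L δ + δ + L) := by
  have hα := alpha_pos hn hL hδ
  have h := (isAlpha_iff hn hL hδ hα).1 (alpha_spec hn hL hδ)
  set s := alpha n L δ + δ
  have hs : 0 < s := by positivity
  refine le_of_mul_le_mul_right ?_ hs
  have h1 : 0 ≤ n * δ * (s + L) * δ := by positivity
  calc s ^ 2 * s = s ^ 3 := by ring
    _ = n * δ * (s + L) * (2 * s - δ) := h
    _ ≤ 2 * n * δ * (s + L) * s := by linarith

theorem alpha_add_div_le (hn : 0 < n) (hL : 0 < L) (hδ : 0 < δ) :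
    (alpha n L δ + δ) / δ ≤ 2 * n + Real.sqrt (2 * n * (L / δ)) := by
  have hα := alpha_pos hn hL hδ
  have h := alpha_add_sq_le hn hL hδ
  set s := alpha n L δ + δ
  have hs : 0 < s := by positivity
  set r := Real.sqrt (2 * n * (L / δ)) with hr
  have hr0 : 0 ≤ r := Real.sqrt_nonneg _
  have hr2 : r ^ 2 * δ = 2 * n * L := by
    rw [hr, Real.sq_sqrt (by positivity)]
    field_simp
  rw [div_le_iff₀ hδ]
  -- Otherwise `s² > 2nδs + δrs ≥ 2nδs + (δr)² = 2nδ(s + L)`.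
  by_contra! hlt
  have h1 : δ * r ≤ s := by
    have : 0 ≤ 2 * n * δ := by positivity
    linarith
  have h2 : (2 * n + r) * δ * s < s * s := mul_lt_mul_of_pos_right hlt hs
  have h3 : δ * r * (δ * r) ≤ δ * r * s := mul_le_mul_of_nonneg_left h1 (by positivity)
  have h4 : δ * r * (δ * r) = 2 * n * δ * L := by
    calc δ * r * (δ * r) = δ * (r ^ 2 * δ) := by ring
      _ = _ := by rw [hr2]; ring
  linarith

/-- The second term of the constant is at most `2Lδ ≤ 2L²`; the total `3L²` is rounded up to a
square. -/
theorem CIDC_le (hn : 0 < n) (hL : 0 < L) (hδ : 0 < δ) (hδL : δ ≤ L) :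
    CIDC n L δ ≤ (2 * L) ^ 2 := by
  have hα := alpha_pos hn hL hδ
  have hn' : (0 : ℝ) < n := by exact_mod_cast hn
  have h1 : L * (1 / (n : ℝ)) * (alpha n L δ + δ) ^ 2 / (alpha n L δ + L + δ) ≤ 2 * L * δ := by
    rw [div_le_iff₀ (by positivity)]
    refine (mul_le_mul_of_nonneg_left (alpha_add_sq_le hn hL hδ) (by positivity)).trans_eq ?_
    field_simp
    ring
  rw [CIDC_eq hn hL hδ]
  nlinarith

theorem breakIndex_le (hn : 0 < n) (hL : 0 < L) (hδ : 0 < δ) (hδL : δ ≤ L) :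
    (breakIndex n L δ : ℝ)
      ≤ (2 * n + Real.sqrt (2 * n * (L / δ))) * Real.log (2 * (L / δ)) + 1 := by
  have hα := alpha_pos hn hL hδ
  have hLδ : 1 ≤ L / δ := (one_le_div hδ).2 hδL
  have hlog : 0 ≤ Real.log (2 * (L / δ)) := Real.log_nonneg (by linarith)
  rcases Nat.eq_zero_or_pos (breakIndex n L δ) with h0 | hpos
  · rw [h0, Nat.cast_zero]
    positivity
  -- The test fails one index earlier; this is the source of the final `+ 1`.
  have hnot : ¬ BreakTest n L δ (breakIndex n L δ - 1) := fun h => by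
    have : breakIndex n L δ ≤ breakIndex n L δ - 1 := Nat.sInf_le h
    omega
  obtain ⟨m, hm⟩ : ∃ m, breakIndex n L δ = m + 1 := ⟨_, (Nat.sub_add_cancel hpos).symm⟩
  rw [hm, Nat.add_sub_cancel, BreakTest, not_le] at hnot
  have h1 : (1 + δ / alpha n L δ) ^ m < 2 * (L / δ) := by
    refine hnot.trans_le ?_
    rw [← mul_div_assoc]
    exact div_le_div_of_nonneg_right (Real.sqrt_le_iff.2 ⟨by positivity, CIDC_le hn hL hδ hδL⟩)
      hδ.le
  have h2 : m * Real.log (1 + δ / alpha n L δ) ≤ Real.log (2 * (L / δ)) := by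
    rw [← Real.log_pow]
    exact Real.log_le_log (by positivity) h1.le
  -- This is `log x ≥ 1 - 1/x` at `x = 1 + δ/α`.
  have h3 : δ / (alpha n L δ + δ) ≤ Real.log (1 + δ / alpha n L δ) := by
    refine le_of_eq_of_le ?_ (Real.one_sub_inv_le_log_of_pos (by positivity))
    field_simp
    ring
  have h4 : m * (δ / (alpha n L δ + δ)) ≤ Real.log (2 * (L / δ)) :=
    (mul_le_mul_of_nonneg_left h3 m.cast_nonneg).trans h2
  have h5 : (m : ℝ) ≤ (alpha n L δ + δ) / δ * Real.log (2 * (L / δ)) := by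
    calc (m : ℝ) = (alpha n L δ + δ) / δ * (m * (δ / (alpha n L δ + δ))) := by field_simp
      _ ≤ _ := mul_le_mul_of_nonneg_left h4 (by positivity)
  rw [hm, Nat.cast_add, Nat.cast_one]
  have h6 := mul_le_mul_of_nonneg_right (alpha_add_div_le hn hL hδ) hlog
  linarith

end Parameters

/-! ### The expected cost -/

section Cost

variable {d n : ℕ} {L ε δ β : ℝ} {f : Fin n → E d → ℝ} {x₀ : E d}
  {Ω : Type*} [MeasurableSpace Ω] {μ : Measure Ω} {i : ℕ → ℕ → Ω → Fin n}
  {b : ℕ → ℕ → Ω → Bool}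

/-- Forgetting the stop test leaves a deterministic number of iterations, `0` to `breakIndex`
inclusive, so no stopping-time argument is needed. -/
theorem loopCost_le (hn : 0 < n) (hL : 0 < L) (hδ : 0 < δ) (i : ℕ → Fin n) (b : ℕ → Bool) :
    loopCost f L ε x₀ δ i b ≤
      n + ∑ k ∈ Finset.range (breakIndex n L δ + 1), if b k then (2 + n : ℝ≥0∞) else 2 := by
  unfold loopCost
  gcongr
  rw [tsum_eq_sum (s := Finset.range (breakIndex n L δ + 1)) fun k hk => ?_]
  · exact Finset.sum_le_sum fun k _ => Set.indicator_le_self' (fun _ _ => zero_le) k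
  · refine Set.indicator_of_notMem (fun h => hk ?_) _
    exact Finset.mem_range.2 (Nat.lt_succ_of_le (le_breakIndex_of_innerReached hn hL hδ h))

theorem IsSampling.lintegral_coin_cost [IsProbabilityMeasure μ] (h : IsSampling μ i b)
    (hn : 0 < n) (t k : ℕ) :
    ∫⁻ ω, (if b t k ω then (2 + n : ℝ≥0∞) else 2) ∂μ = 3 := by
  have hm : MeasurableSet {ω | b t k ω = true} :=
    h.measurable_coin t k (measurableSet_singleton true)
  have e : ∀ ω, (if b t k ω then (2 + n : ℝ≥0∞) else 2)
      = 2 + Set.indicator {ω | b t k ω = true} (fun _ => (n : ℝ≥0∞)) ω := fun ω => by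
    by_cases hb : b t k ω = true <;> simp [hb]
  have hμ : μ {ω | b t k ω = true} = ENNReal.ofReal (1 / (n : ℝ)) := by
    rw [← h.coin t k, ofReal_measureReal]
  have hn' : (n : ℝ) ≠ 0 := by exact_mod_cast hn.ne'
  simp_rw [e]
  rw [lintegral_add_left measurable_const, lintegral_indicator_const hm, hμ, ← ENNReal.ofReal_natCast n,
    ← ENNReal.ofReal_mul (by positivity), mul_one_div_cancel hn', lintegral_const, measure_univ,
    ENNReal.ofReal_one, mul_one]
  norm_num

theorem IsSampling.measurable_coin_cost (h : IsSampling μ i b) (t k : ℕ) :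
    Measurable fun ω => if b t k ω then (2 + n : ℝ≥0∞) else 2 :=
  Measurable.ite (h.measurable_coin t k (measurableSet_singleton true)) measurable_const
    measurable_const

theorem IsSampling.lintegral_totalCost_le [IsProbabilityMeasure μ] (h : IsSampling μ i b)
    (hn : 0 < n) (hL : 0 < L) (hβ : 1 < β) (l : ℕ) :
    ∫⁻ ω, totalCost f L ε β x₀ (fun t k => i t k ω) (fun t k => b t k ω) l ∂μ ≤
      ENNReal.ofReal (∑ t ∈ Finset.range (l + 1),
        (n + 3 * ((breakIndex n L (delta L β t) : ℝ) + 1))) := by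
  calc ∫⁻ ω, totalCost f L ε β x₀ (fun t k => i t k ω) (fun t k => b t k ω) l ∂μ
      ≤ ∫⁻ ω, ∑ t ∈ Finset.range (l + 1), (n + ∑ k ∈ Finset.range
          (breakIndex n L (delta L β t) + 1), if b t k ω then (2 + n : ℝ≥0∞) else 2) ∂μ := by
        refine lintegral_mono fun ω => Finset.sum_le_sum fun t _ => ?_
        exact (Set.indicator_le_self' (fun _ _ => zero_le) t).trans
          (loopCost_le hn hL (delta_pos hL hβ t) _ _)
    _ = ∑ t ∈ Finset.range (l + 1), ((n : ℝ≥0∞) + (breakIndex n L (delta L β t) + 1 : ℕ) * 3) := by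
        have hm : ∀ t, Measurable fun ω => (n : ℝ≥0∞) + ∑ k ∈ Finset.range
            (breakIndex n L (delta L β t) + 1), if b t k ω then (2 + n : ℝ≥0∞) else 2 := fun t =>
          measurable_const.add (Finset.measurable_fun_sum _ fun k _ => h.measurable_coin_cost t k)
        rw [lintegral_finsetSum _ fun t _ => hm t]
        refine Finset.sum_congr rfl fun t _ => ?_
        rw [lintegral_add_left measurable_const, lintegral_const, measure_univ, mul_one,
          lintegral_finsetSum _ fun k _ => h.measurable_coin_cost t k]
        simp_rw [h.lintegral_coin_cost hn]
        rw [Finset.sum_const, Finset.card_range, nsmul_eq_mul]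
    _ = _ := by
        rw [ENNReal.ofReal_sum_of_nonneg fun t _ => by positivity]
        refine Finset.sum_congr rfl fun t _ => ?_
        rw [ENNReal.ofReal_add (by positivity) (by positivity), ENNReal.ofReal_mul (by positivity),
          ENNReal.ofReal_natCast, ← Nat.cast_succ, ENNReal.ofReal_natCast, mul_comm]
        norm_num

end Cost

/-! ### Summation over the outer iterations -/

/-- Applied with `M = LR₀/(εq)`; the condition on `s < l` encodes the minimality of `ℓ`. It says
nothing when `l = 0`, where `M` may be tiny, hence the case splits and the maximum with `1`. -/
theorem sum_iteration_bounds_le {β : ℝ} (hβ : 1 < β) :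
    ∃ C : ℝ, 0 < C ∧ ∀ (n : ℕ) (_ : 0 < n) (M : ℝ) (_ : 0 < M) (l : ℕ) (_ : ∀ s < l, β ^ s < 2 * M),
      ∑ t ∈ Finset.range (l + 1),
          (n + 3 * ((2 * n + Real.sqrt (2 * n * β ^ t)) * Real.log (2 * β ^ t) + 1 + 1))
        ≤ C * ((n * max 1 (Real.log M) + Real.sqrt (n * M)) * max 1 (Real.log M)) := by
  have hβ0 : 0 < β := one_pos.trans hβ
  have hlogβ : 0 < Real.log β := Real.log_pos hβ
  have hlog2 : 0 < Real.log 2 := Real.log_pos one_lt_two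
  set r := Real.sqrt β with hr
  have hr1 : 1 < r := Real.lt_sqrt_of_sq_lt (by simpa using hβ)
  have hr0 : 0 < r - 1 := sub_pos.2 hr1
  have hr2 : r ^ 2 = β := Real.sq_sqrt hβ0.le
  -- `c₁` comes from `2β^t ≤ 4βM`, `c₂` from `l - 1 ≤ log(2M)/log β`, and `c₃` from the geometric
  -- sum with ratio `√β`.
  set c₁ := 2 * Real.log 2 + Real.log β + 1 with hc₁
  set c₂ := 2 + (Real.log 2 + 1) / Real.log β with hc₂
  set c₃ := r / (r - 1) * (2 + 2 * r) with hc₃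
  have hc₁0 : 0 < c₁ := by positivity
  have hc₂0 : 0 < c₂ := by positivity
  have hc₃0 : 0 < c₃ := by positivity
  refine ⟨7 * c₂ + 3 * c₁ * (2 * c₂ + c₃), by positivity, fun n hn M hM l hl => ?_⟩
  have hn1 : (1 : ℝ) ≤ n := by exact_mod_cast hn
  set Λ := max 1 (Real.log M) with hΛ
  have hΛ1 : 1 ≤ Λ := le_max_left _ _
  have hΛM : Real.log M ≤ Λ := le_max_right _ _
  set S := Real.sqrt (n * M) with hS
  have hS0 : 0 ≤ S := Real.sqrt_nonneg _
  have hlogt : ∀ t ≤ l, Real.log (2 * β ^ t) ≤ c₁ * Λ := by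
    intro t ht
    rcases Nat.eq_zero_or_pos l with rfl | hpos
    · rw [Nat.le_zero.1 ht, pow_zero, mul_one]
      nlinarith
    · obtain ⟨m, rfl⟩ : ∃ m, l = m + 1 := ⟨_, (Nat.sub_add_cancel hpos).symm⟩
      have h1 : 2 * β ^ t ≤ 2 * 2 * β * M := by
        have h2 := pow_le_pow_right₀ hβ.le ht
        have h3 := mul_lt_mul_of_pos_left (hl m m.lt_succ_self) hβ0
        rw [pow_succ] at h2
        linarith
      have h2 := Real.log_le_log (by positivity) h1
      rw [Real.log_mul (by positivity) hM.ne', Real.log_mul (by positivity) hβ0.ne',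
        Real.log_mul two_ne_zero two_ne_zero] at h2
      nlinarith
  have hlen : ((l + 1 : ℕ) : ℝ) ≤ c₂ * Λ := by
    have hc₂1 : 2 ≤ c₂ := le_add_of_nonneg_right (by positivity)
    rcases Nat.eq_zero_or_pos l with rfl | hpos
    · rw [zero_add, Nat.cast_one]
      nlinarith
    · obtain ⟨m, rfl⟩ : ∃ m, l = m + 1 := ⟨_, (Nat.sub_add_cancel hpos).symm⟩
      have h1 := Real.log_le_log (by positivity) (hl m m.lt_succ_self).le
      rw [Real.log_pow, Real.log_mul two_ne_zero hM.ne'] at h1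
      have h2 : (m : ℝ) ≤ (Real.log 2 + 1) / Real.log β * Λ := by
        rw [div_mul_eq_mul_div, le_div_iff₀ hlogβ]
        nlinarith
      push_cast
      rw [hc₂, add_mul]
      linarith
  have hgeom : ∑ t ∈ Finset.range (l + 1), Real.sqrt (2 * n * β ^ t) ≤ c₃ * (n * Λ + S) := by
    -- The summand `1` covers `l = 0`.
    have hpow : r ^ l ≤ 1 + Real.sqrt (2 * M) * r := by
      rcases Nat.eq_zero_or_pos l with rfl | hpos
      · rw [pow_zero]
        exact le_add_of_nonneg_right (by positivity)
      · obtain ⟨m, rfl⟩ : ∃ m, l = m + 1 := ⟨_, (Nat.sub_add_cancel hpos).symm⟩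
        have h1 : r ^ m ≤ Real.sqrt (2 * M) := by
          refine Real.le_sqrt_of_sq_le ?_
          rw [← pow_mul, mul_comm, pow_mul, hr2]
          exact (hl m m.lt_succ_self).le
        rw [pow_succ]
        have := mul_le_mul_of_nonneg_right h1 (Real.sqrt_nonneg β)
        linarith
    have h1 : ∀ t, Real.sqrt (2 * n * β ^ t) = Real.sqrt (2 * n) * r ^ t := fun t => by
      rw [Real.sqrt_mul (by positivity), ← hr2, ← pow_mul, mul_comm 2 t, pow_mul,
        Real.sqrt_sq (by positivity)]
    have h2 : ∑ t ∈ Finset.range (l + 1), r ^ t ≤ r / (r - 1) * r ^ l := by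
      rw [geom_sum_eq hr1.ne', div_mul_eq_mul_div, ← pow_succ']
      exact div_le_div_of_nonneg_right (by linarith) hr0.le
    have h3 : Real.sqrt (2 * n) ≤ 2 * n := Real.sqrt_le_iff.2 ⟨by positivity, by nlinarith⟩
    have h4 : Real.sqrt (2 * n) * Real.sqrt (2 * M) = 2 * S := by
      rw [← Real.sqrt_mul (by positivity), show 2 * (n : ℝ) * (2 * M) = 2 ^ 2 * (n * M) by ring,
        Real.sqrt_mul (by positivity), Real.sqrt_sq two_pos.le]
    have h5 : (n : ℝ) ≤ n * Λ := le_mul_of_one_le_right (by positivity) hΛ1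
    simp_rw [h1]
    rw [← Finset.mul_sum]
    calc Real.sqrt (2 * n) * ∑ t ∈ Finset.range (l + 1), r ^ t
        ≤ Real.sqrt (2 * n) * (r / (r - 1) * (1 + Real.sqrt (2 * M) * r)) :=
          mul_le_mul_of_nonneg_left (h2.trans (mul_le_mul_of_nonneg_left hpow (by positivity)))
            (Real.sqrt_nonneg _)
      _ = r / (r - 1) * (Real.sqrt (2 * n) + Real.sqrt (2 * n) * Real.sqrt (2 * M) * r) := by ring
      _ ≤ r / (r - 1) * ((2 + 2 * r) * (n * Λ + S)) := by
          refine mul_le_mul_of_nonneg_left ?_ (by positivity)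
          rw [h4]
          have : 0 ≤ r * (n * Λ) := by positivity
          nlinarith
      _ = c₃ * (n * Λ + S) := by rw [hc₃]; ring
  -- The factor `7` comes from `n + 6 ≤ 7n`.
  have hterm : ∀ t ∈ Finset.range (l + 1),
      (n : ℝ) + 3 * ((2 * n + Real.sqrt (2 * n * β ^ t)) * Real.log (2 * β ^ t) + 1 + 1)
        ≤ (7 * n + 3 * (c₁ * Λ) * (2 * n)) + 3 * (c₁ * Λ) * Real.sqrt (2 * n * β ^ t) := by
    intro t ht
    have h1 := mul_le_mul_of_nonneg_left (hlogt t (Nat.lt_succ_iff.1 (Finset.mem_range.1 ht)))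
      (by positivity : 0 ≤ 2 * n + Real.sqrt (2 * n * β ^ t))
    linarith
  calc _ ≤ _ := Finset.sum_le_sum hterm
    _ = ((l + 1 : ℕ) : ℝ) * (7 * n + 3 * (c₁ * Λ) * (2 * n))
        + 3 * (c₁ * Λ) * ∑ t ∈ Finset.range (l + 1), Real.sqrt (2 * n * β ^ t) := by
        rw [Finset.sum_add_distrib, Finset.sum_const, Finset.card_range, nsmul_eq_mul,
          Finset.mul_sum]
    _ ≤ c₂ * Λ * (7 * n + 3 * (c₁ * Λ) * (2 * n)) + 3 * (c₁ * Λ) * (c₃ * (n * Λ + S)) := by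
        gcongr
    _ = (7 * c₂) * (n * 1 * Λ) + 3 * c₁ * (2 * c₂) * (n * Λ * Λ)
        + 3 * c₁ * c₃ * ((n * Λ + S) * Λ) := by ring
    _ ≤ (7 * c₂) * ((n * Λ + S) * Λ) + 3 * c₁ * (2 * c₂) * ((n * Λ + S) * Λ)
        + 3 * c₁ * c₃ * ((n * Λ + S) * Λ) := by
        have h1 : (n : ℝ) * 1 ≤ n * Λ + S :=
          (mul_le_mul_of_nonneg_left hΛ1 (by positivity)).trans (le_add_of_nonneg_right hS0)
        have h2 : (n : ℝ) * Λ ≤ n * Λ + S := le_add_of_nonneg_right hS0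
        gcongr
    _ = _ := by ring

/-! ### Combining the outer iterations -/

section Termination

variable {d n : ℕ} {L ε β : ℝ} {f : Fin n → E d → ℝ} {x₀ : E d}
  {Ω : Type*} [MeasurableSpace Ω] {μ : Measure Ω} {i : ℕ → ℕ → Ω → Fin n}
  {b : ℕ → ℕ → Ω → Bool}

/-- An algorithm that does not reach outer iteration `l` has terminated before. -/
theorem exists_terminatesAt_of_not_outerReached (hn : 0 < n) (hL : 0 < L) (hβ : 1 < β)
    {i : ℕ → ℕ → Fin n} {b : ℕ → ℕ → Bool} {l : ℕ} (h : ¬ OuterReached f L ε β x₀ i b l) :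
    ∃ t ≤ l, TerminatesAt f L ε β x₀ i b t := by
  classical
  have hex : ∃ s, s < l ∧ ¬ LoopBreaks f L ε x₀ (delta L β s) (i s) (b s) := by
    unfold OuterReached at h
    push Not at h
    exact h
  have hspec := Nat.find_spec hex
  refine ⟨Nat.find hex, hspec.1.le, fun s hs => ?_, ?_⟩
  · by_contra hb
    exact Nat.find_min hex hs ⟨hs.trans hspec.1, hb⟩
  · exact not_not.1 fun ht => hspec.2 ((loopBreaks_iff hn hL (delta_pos hL hβ _)).2 ht)

/-- Reaching iteration `l` is decided by finitely many samples with first index below `l`,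
termination in it by samples with first index `l`. -/
theorem IsSampling.indep_outerReached_loopTerminates (h : IsSampling μ i b) (hn : 0 < n)
    (hL : 0 < L) (hβ : 1 < β) (l : ℕ) :
    IndepFun
      (fun ω => OuterReached f L ε β x₀ (fun t k => i t k ω) (fun t k => b t k ω) l)
      (fun ω => LoopTerminates f L ε x₀ (delta L β l) (fun k => i l k ω) (fun k => b l k ω)) μ := by
  refine indepFun_of_dependsOn (W := samples i b) (dependsOn_outerReached hn hL hβ l)
    (dependsOn_loopTerminates hn hL (delta_pos hL hβ l) l) ?_ h.measurable_samples h.indep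
  rw [Finset.disjoint_biUnion_left]
  intro s hs
  rw [history, history, Finset.disjoint_product]
  exact Or.inl (Finset.disjoint_singleton.2 (Finset.mem_range.1 hs).ne)

theorem IsSampling.measurableSet_outerReached (h : IsSampling μ i b) (hn : 0 < n)
    (hL : 0 < L) (hβ : 1 < β) (l : ℕ) :
    MeasurableSet
      {ω | OuterReached f L ε β x₀ (fun t k => i t k ω) (fun t k => b t k ω) l} :=
  measurableSet_setOfPred.2 (measurable_of_dependsOn (W := samples i b)
    (dependsOn_outerReached hn hL hβ l) h.measurable_samples)

theorem IsSampling.prob_terminatesAt (h : IsSampling μ i b) (hn : 0 < n) (hL : 0 < L)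
    (hβ : 1 < β) (l : ℕ) :
    μ.real {ω | TerminatesAt f L ε β x₀ (fun t k => i t k ω) (fun t k => b t k ω) l}
      = μ.real {ω | OuterReached f L ε β x₀ (fun t k => i t k ω) (fun t k => b t k ω) l}
        * μ.real {ω | LoopTerminates f L ε x₀ (delta L β l) (fun k => i l k ω)
            (fun k => b l k ω)} := by
  have h1 := (h.indep_outerReached_loopTerminates (f := f) (ε := ε) (x₀ := x₀) hn hL hβ
    l).measure_inter_preimage_eq_mul {True} {True} (MeasurableSet.singleton _)
    (MeasurableSet.singleton _)
  have e : ∀ P : Ω → Prop, P ⁻¹' {True} = {ω | P ω} := fun P => by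
    ext ω
    simp
  rw [e, e] at h1
  rw [measureReal_def, measureReal_def, measureReal_def, ← ENNReal.toReal_mul, ← h1]
  rfl

end Termination

end RAccSVRG

end

theorem mainTheorem9 (β : ℝ) (hβ : 1 < β) :
    ∃ C : ℝ, 0 < C ∧
      ∀ (d n : ℕ) (_ : 0 < n) (L ε : ℝ) (_ : 0 < L) (_ : 0 < ε)
        (f : Fin n → RAccSVRG.E d → ℝ) (_ : ∀ j, RAccSVRG.IsConvexSmooth L (f j))
        (x₀ : RAccSVRG.E d)
        (Ω : Type*) (_ : MeasurableSpace Ω) (μ : Measure Ω) (_ : IsProbabilityMeasure μ)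
        (i : ℕ → ℕ → Ω → Fin n) (b : ℕ → ℕ → Ω → Bool) (_ : RAccSVRG.IsSampling μ i b)
        (xs : RAccSVRG.E d) (_ : IsMinOn (RAccSVRG.avg f) Set.univ xs)
        (R₀ : ℝ) (_ : 0 < R₀) (_ : ‖x₀ - xs‖ ≤ R₀)
        (q : ℝ) (_ : 0 < q) (_ : q < 1)
        (l : ℕ) (_ : IsLeast {t : ℕ | RAccSVRG.delta L β t ≤ ε * q / (2 * R₀)} l),
        -- once outer iteration `l` is reached, it terminates with probability at least `1 - q`
        (1 - q) * μ.real {ω | RAccSVRG.OuterReached f L ε β x₀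
              (fun t k => i t k ω) (fun t k => b t k ω) l} ≤
            μ.real {ω | RAccSVRG.TerminatesAt f L ε β x₀
              (fun t k => i t k ω) (fun t k => b t k ω) l} ∧
        -- hence it has terminated by the end of outer iteration `l` with that probability
        1 - q ≤ μ.real {ω | ∃ t ≤ l, RAccSVRG.TerminatesAt f L ε β x₀
              (fun t k => i t k ω) (fun t k => b t k ω) t} ∧
        -- expected number of component gradients in outer iterations `0, …, l`
        ∫⁻ ω, RAccSVRG.totalCost f L ε β x₀ (fun t k => i t k ω) (fun t k => b t k ω) l ∂μ ≤
          ENNReal.ofReal (C * ((n * max 1 (Real.log (L * R₀ / (ε * q)))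
              + Real.sqrt (n * L * R₀ / (ε * q))) *
            max 1 (Real.log (L * R₀ / (ε * q))))) := by
  obtain ⟨C, hC, hsum⟩ := RAccSVRG.sum_iteration_bounds_le hβ
  refine ⟨C, hC, ?_⟩
  intro d n hn L ε hL hε f hf x₀ Ω _ μ _ i b h xs hxs R₀ hR hxR q hq hq1 l hl
  have hδ := RAccSVRG.delta_pos hL hβ
  have hi : (1 - q) * μ.real {ω | RAccSVRG.OuterReached f L ε β x₀
      (fun t k => i t k ω) (fun t k => b t k ω) l} ≤
      μ.real {ω | RAccSVRG.TerminatesAt f L ε β x₀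
        (fun t k => i t k ω) (fun t k => b t k ω) l} := by
    rw [h.prob_terminatesAt hn hL hβ l, mul_comm]
    exact mul_le_mul_of_nonneg_left
      (h.one_sub_le_prob_loopTerminates hn hL (hδ l) hε hf hxs hR hxR hl.1 l) measureReal_nonneg
  refine ⟨hi, ?_, ?_⟩
  · set A := {ω | RAccSVRG.OuterReached f L ε β x₀ (fun t k => i t k ω) (fun t k => b t k ω) l}
      with hA
    set T := {ω | RAccSVRG.TerminatesAt f L ε β x₀ (fun t k => i t k ω) (fun t k => b t k ω) l}
    have hAm : MeasurableSet A := h.measurableSet_outerReached hn hL hβ l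
    have hdisj : Disjoint T Aᶜ := Set.disjoint_left.2 fun ω hT hAc => hAc hT.1
    have hunion : μ.real (T ∪ Aᶜ) = μ.real T + (1 - μ.real A) := by
      rw [measureReal_union hdisj hAm.compl, probReal_compl_eq_one_sub hAm]
    have hsub : T ∪ Aᶜ ⊆ {ω | ∃ t ≤ l, RAccSVRG.TerminatesAt f L ε β x₀
        (fun t k => i t k ω) (fun t k => b t k ω) t} := by
      rintro ω (hT | hAc)
      · exact ⟨l, le_rfl, hT⟩
      · exact RAccSVRG.exists_terminatesAt_of_not_outerReached hn hL hβ hAc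
    have h1 := measureReal_mono (μ := μ) hsub
    -- The union has probability at least `(1 - q)P(A) + 1 - P(A) = 1 - qP(A)`.
    have h2 : q * μ.real A ≤ q * 1 := mul_le_mul_of_nonneg_left measureReal_le_one hq.le
    linarith
  · refine (h.lintegral_totalCost_le hn hL hβ l).trans (ENNReal.ofReal_le_ofReal ?_)
    have hM : 0 < L * R₀ / (ε * q) := by positivity
    -- Minimality of `l` means `δ_s > εq/(2R₀)` for `s < l`.
    have hlt : ∀ s < l, β ^ s < 2 * (L * R₀ / (ε * q)) := by
      intro s hs
      have hβs : 0 < β ^ s := pow_pos (one_pos.trans hβ) s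
      have h1 : ε * q / (2 * R₀) < L / β ^ s := by
        rw [← RAccSVRG.delta_eq]
        exact not_le.1 fun hle => (hl.2 hle).not_gt hs
      rw [div_lt_div_iff₀ (by positivity) hβs] at h1
      rw [← mul_div_assoc, lt_div_iff₀ (by positivity)]
      linarith
    have hle := hsum n hn _ hM l hlt
    rw [show (n : ℝ) * (L * R₀ / (ε * q)) = n * L * R₀ / (ε * q) by ring] at hle
    refine (Finset.sum_le_sum fun t _ => ?_).trans hle
    have hβt : 1 ≤ β ^ t := one_le_pow₀ hβ.le
    have hδt : L / RAccSVRG.delta L β t = β ^ t := by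
      rw [RAccSVRG.delta_eq]
      field_simp
    have hδL : RAccSVRG.delta L β t ≤ L := by
      rw [RAccSVRG.delta_eq]
      exact div_le_self hL.le hβt
    have hK := RAccSVRG.breakIndex_le hn hL (hδ t) hδL
    rw [hδt] at hK
    linarith
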